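/- Let $\mathcal X$ be a stack in groupoids for the fppf topology on the category of schemes, let $Y$ be an affine scheme, and let $\pi\colon Y\to\mathcal X$ be a morphism which is representable by schemes, surjective, and finite locally free of constant degree $d\ge 0$; that is, for every scheme $U$ and every morphism $U\to\mathcal X$ the $2$-fibre product $U\times_{\mathcal X}Y$ is a scheme whose projection to $U$ is surjective, finite, flat, locally of finite presentation and of rank $d$ at every point of $U$. (Such an $\mathcal X$ is automatically an algebraic stack, and the algebraic stacks which admit a surjective finite locally free morphism from an affine scheme are called well-nigh affine.) Let $\mathcal O_{\mathcal X}$ be the structure sheaf on the fppf site of $\mathcal X$, whose objects are the pairs $(S,x)$ with $S$ a scheme and $x\in\mathcal X(S)$; call an $\mathcal O_{\mathcal X}$-module $F$ quasi-coherent if $F(S,x)\otimes_{\Gamma(S,\mathcal O_S)}\Gamma(T,\mathcal O_T)\to F(T,y)$ is an isomorphism for every morphism $(T,y)\to(S,x)$ with $S$ and $T$ affine; and let $H^n(\mathcal X,F)$ denote sheaf cohomology on this site. Then for all $n\ge 1$: 1. $d\cdot H^n(\mathcal X,\mathcal O_{\mathcal X})=0$; 2. $d\cdot H^n(\mathcal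 X,F)=0$ for every quasi-coherent $\mathcal O_{\mathcal X}$-module $F$. -/

import Mathlib

open CategoryTheory Opposite AlgebraicGeometry CategoryTheory.Pseudofunctor Bicategory
open CategoryTheory.Pseudofunctor.LocallyDiscreteOpToCat

universe u

namespace WellNighAffine

/-- A pseudofunctor `Schᵒᵖ → Cat`, i.e. a fibered category over the category of schemes (the
fibre over a scheme `S` is `X.obj ⟨op S⟩`). -/
abbrev FiberedCat := LocallyDiscrete Scheme.{u}ᵒᵖ ⥤ᵖ Cat.{u, u + 1}

/-- A stack in groupoids over the category of schemes, for the fppf topology. -/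
class IsFppfStack (X : FiberedCat.{u}) : Prop where
  isGroupoid : ∀ S, IsGroupoid (X.obj S)
  isStack : X.IsStack Scheme.fppfTopology.{u}

attribute [instance] IsFppfStack.isGroupoid IsFppfStack.isStack

section Site

variable {X : FiberedCat.{u}}

lemma exists_cartesianLift (b : CoGrothendieck X) {T : Scheme.{u}} (t : T ⟶ b.base) :
    ∃ (x : X.obj ⟨op T⟩) (f : (⟨T, x⟩ : CoGrothendieck X) ⟶ b), f.base = t :=
  ⟨_, CoGrothendieck.cartesianLift b.fiber t, rfl⟩

variable [IsFppfStack X]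

lemma exists_lift {a b c : CoGrothendieck X} (f : a ⟶ b) (g : c ⟶ b)
    (h : c.base ⟶ a.base) (w : h ≫ f.base = g.base) :
    ∃ k : c ⟶ a, k.base = h ∧ k ≫ f = g := by
  obtain ⟨gb, gf⟩ := g
  obtain rfl : h ≫ f.base = gb := w
  have := IsGroupoid.all_isIso f.fiber
  refine ⟨⟨h, gf ≫ (X.mapComp f.base.op.toLoc h.op.toLoc).hom.toNatTrans.app b.fiber ≫
    (X.map h.op.toLoc).toFunctor.map (inv f.fiber)⟩, rfl, ?_⟩
  refine CoGrothendieck.Hom.ext _ _ rfl ?_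
  have e : (X.mapComp f.base.op.toLoc h.op.toLoc).hom.toNatTrans.app b.fiber ≫
      (X.mapComp f.base.op.toLoc h.op.toLoc).inv.toNatTrans.app b.fiber = 𝟙 _ := by
    rw [← Cat.Hom₂.comp_app, Iso.hom_inv_id]; rfl
  have e' : (X.map h.op.toLoc).toFunctor.map (inv f.fiber) ≫
      (X.map h.op.toLoc).toFunctor.map f.fiber = 𝟙 _ := by
    rw [← Functor.map_comp, IsIso.inv_hom_id, CategoryTheory.Functor.map_id]
  have key {A B C D : X.obj ⟨op c.base⟩} (g : A ⟶ B) (i : B ⟶ C) (p : C ⟶ D) (q : D ⟶ C)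
      (j : C ⟶ B) (hij : i ≫ j = 𝟙 _) (hpq : p ≫ q = 𝟙 _) :
      (g ≫ i ≫ p) ≫ q ≫ j = g ≫ 𝟙 _ := by
    simp [reassoc_of% hpq, hij]
  exact key _ _ _ _ _ e e'

/-- The fppf topology on the total category of a stack `X` (objects are pairs `(S, x)` with `S` a
scheme and `x` an object of `X` over `S`): a sieve on `(S, x)` is covering if the
morphisms of schemes underlying its members generate an fppf covering sieve of `S`. -/
def fppfSite (X : FiberedCat.{u}) [IsFppfStack X] : GrothendieckTopology (CoGrothendieck X) where
  sieves x := {R | R.functorPushforward (CoGrothendieck.forget X) ∈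
    Scheme.fppfTopology.{u} x.base}
  top_mem' x := by
    have : (⊤ : Sieve x).functorPushforward (CoGrothendieck.forget X) = ⊤ :=
      Sieve.functorPushforward_top _ _
    simp only [Set.mem_ofPred_eq, this]
    exact GrothendieckTopology.top_mem _ _
  pullback_stable' := by
    intro x x' R f hR
    refine Scheme.fppfTopology.superset_covering ?_
      (Scheme.fppfTopology.pullback_stable f.base hR)
    rintro T t ⟨z, r, h, hr, w⟩
    obtain ⟨y, g, hg⟩ := exists_cartesianLift x' t
    obtain ⟨k, -, hk⟩ := exists_lift r (g ≫ f) h (by simp only [CoGrothendieck.categoryStruct_comp_base, hg]; exact w.symm)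
    refine ⟨_, g, 𝟙 _, ?_, by simpa using! hg.symm⟩
    change R.arrows (g ≫ f)
    rw [← hk]
    exact R.downward_closed hr k
  transitive' := by
    intro x R hR S hS
    refine Scheme.fppfTopology.transitive hR _ ?_
    rintro T _ ⟨z, r, h, hr, rfl⟩
    refine (Sieve.pullback_comp (g := h) (f := r.base) (S := S.functorPushforward (CoGrothendieck.forget X))).symm ▸ Scheme.fppfTopology.pullback_stable h
      (Scheme.fppfTopology.superset_covering ?_ (hS hr))
    rintro V _ ⟨y, s, k, hs, rfl⟩
    exact ⟨y, s ≫ r, k, hs, Category.assoc k s.base r.base⟩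

lemma isContinuous_forget :
    (CoGrothendieck.forget X).IsContinuous (fppfSite X) Scheme.fppfTopology.{u} := by
  refine Functor.isContinuous_of_coverPreserving ⟨?_⟩ ⟨fun hS ↦ hS⟩
  intro ℱ Z T s hs Y₁ Y₂ V h₁ h₂ g₁ g₂ hg₁ hg₂ w
  obtain ⟨y, g, hg⟩ := exists_cartesianLift Z (h₁ ≫ (CoGrothendieck.forget X).map g₁)
  obtain ⟨k₁, rfl, hk₁⟩ := exists_lift g₁ g h₁ hg.symm
  obtain ⟨k₂, rfl, hk₂⟩ := exists_lift g₂ g h₂ (by rw [hg]; exact w.symm)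
  exact hs k₁ k₂ hg₁ hg₂ (hk₁.trans hk₂.symm)

end Site

/-- Global functions on a scheme are the morphisms to the affine line. -/
noncomputable def ΓIso : (Scheme.Γ.{u} ⋙ forget CommRingCat.{u}) ≅
    yoneda.obj (Spec (.of (MvPolynomial PUnit.{u+1} (ULift.{u} ℤ)))) :=
  (NatIso.ofComponents (fun S ↦ ((AffineSpace.toSpecMvPolyIntEquiv PUnit.{u+1} (X := S.unop)).trans
    (Equiv.funUnique PUnit.{u+1} _)).toIso) (fun f ↦ by
      ext g; rfl)).symm

/-- The structure sheaf on schemes, `S ↦ Γ(S, 𝒪_S)`, is an fppf sheaf. -/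
lemma isSheaf_Γ : Presheaf.IsSheaf Scheme.fppfTopology.{u}
    (Scheme.Γ ⋙ forget₂ CommRingCat.{u} RingCat.{u}) := by
  have h : Presieve.IsSheaf Scheme.fppfTopology.{u} (Scheme.Γ.{u} ⋙ forget CommRingCat.{u}) :=
    Presieve.isSheaf_iso _ ΓIso.symm (GrothendieckTopology.Subcanonical.isSheaf_of_isRepresentable _)
  intro E S R hR x hx
  have h' := h R hR
  have hc (e : E) : Presieve.FamilyOfElements.Compatible
      (P := Scheme.Γ.{u} ⋙ forget CommRingCat.{u}) (fun T f hf ↦ (x f hf).hom e) := by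
    intro Y₁ Y₂ Z g₁ g₂ f₁ f₂ h₁ h₂ w
    have := hx g₁ g₂ h₁ h₂ w
    exact congr($(this).hom e)
  have hsep := h'.isSeparatedFor
  let a (e : E) : Γ(S, ⊤) := h'.amalgamate _ (hc e)
  have ha (e : E) (T : Scheme.{u}) (f : T ⟶ S) (hf : R f) : f.appTop (a e) = (x f hf).hom e :=
    h'.valid_glue (hc e) f hf
  have hext (s t : Γ(S, ⊤)) (hst : ∀ (T : Scheme.{u}) (f : T ⟶ S), R f → f.appTop s = f.appTop t) :
      s = t := hsep.ext (fun T f hf ↦ hst T f hf)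
  let φ : E →+* Γ(S, ⊤) :=
    { toFun := a
      map_one' := hext _ _ fun T f hf ↦ by
        rw [ha _ _ _ hf, map_one, map_one]; rfl
      map_mul' := fun e e' ↦ hext _ _ fun T f hf ↦ by
        rw [ha _ _ _ hf, map_mul, map_mul, ha _ _ _ hf, ha _ _ _ hf]; rfl
      map_zero' := hext _ _ fun T f hf ↦ by
        rw [ha _ _ _ hf, map_zero, map_zero]; rfl
      map_add' := fun e e' ↦ hext _ _ fun T f hf ↦ by
        rw [ha _ _ _ hf, map_add, map_add, ha _ _ _ hf, ha _ _ _ hf]; rfl }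
  refine ⟨RingCat.ofHom φ, fun T f hf ↦ ?_, fun ψ hψ ↦ ?_⟩
  · refine RingCat.hom_ext (RingHom.ext fun e ↦ ?_)
    exact ha e T f hf
  · refine RingCat.hom_ext (RingHom.ext fun e ↦ ?_)
    refine hext _ _ fun T f hf ↦ ?_
    refine Eq.trans ?_ (ha e T f hf).symm
    exact congr($(hψ f hf).hom e)

section Modules

variable (X : FiberedCat.{u}) [IsFppfStack X]

/-- The structure sheaf `𝒪_X` of the stack `X`: `(S, x) ↦ Γ(S, 𝒪_S)`. -/
def structureSheaf : Sheaf (fppfSite X) RingCat.{u} :=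
  haveI := isContinuous_forget (X := X)
  ((CoGrothendieck.forget X).sheafPushforwardContinuous RingCat.{u} (fppfSite X)
    Scheme.fppfTopology.{u}).obj ⟨_, isSheaf_Γ⟩

variable {X}

/-- The sections of an `𝒪_X`-module `F` over `x : S → X`, as a `Γ(S, 𝒪_S)`-module. -/
def sections (F : SheafOfModules.{u} (structureSheaf X)) (x : CoGrothendieck X) :
    ModuleCat.{u} Γ(x.base, ⊤) :=
  F.val.obj (op x)

/-- The restriction map of sections of an `𝒪_X`-module along `f : (T, y) → (S, x)`, as a
`Γ(S, 𝒪_S)`-linear map. -/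
def restrict (F : SheafOfModules.{u} (structureSheaf X)) {y x : CoGrothendieck X} (f : y ⟶ x) :
    sections F x ⟶ (ModuleCat.restrictScalars f.base.appTop.hom).obj (sections F y) :=
  F.val.map f.op

/-- An `𝒪_X`-module `F` is quasi-coherent if for every morphism `f : (T, y) → (S, x)` with `T` and
`S` affine, the map `F(S, x) ⊗_{Γ(S, 𝒪)} Γ(T, 𝒪) → F(T, y)` induced by restriction
is an isomorphism. -/
def IsQuasiCoherent (F : SheafOfModules.{u} (structureSheaf X)) : Prop :=
  ∀ ⦃y x : CoGrothendieck X⦄ (f : y ⟶ x) [IsAffine y.base] [IsAffine x.base],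
    IsIso (((ModuleCat.extendRestrictScalarsAdj f.base.appTop.hom).homEquiv _ _).symm
      (restrict F f))

instance : IsGrothendieckAbelian.{u + 1} (Sheaf (fppfSite X) AddCommGrpCat.{u + 1}) := by
  have : EssentiallySmall.{u + 1} (CoGrothendieck X) := inferInstance
  exact Sheaf.isGrothendieckAbelian_of_essentiallySmall (fppfSite X) AddCommGrpCat.{u + 1}

/-- The sheaf cohomology `H^n(X, F)` of an `𝒪_X`-module `F` on the fppf site of the stack `X`.
(Since the site is large, the values of `F` are lifted to the next universe.) -/
noncomputable abbrev Cohomology (F : SheafOfModules.{u} (structureSheaf X)) (n : ℕ) : Type (u + 1) :=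
  ((sheafCompose (fppfSite X) AddCommGrpCat.uliftFunctor.{u + 1, u}).obj
    ((SheafOfModules.toSheaf (structureSheaf X)).obj F)).H n

end Modules

section Cover

variable {X : FiberedCat.{u}}

/-- A scheme `P` representing the 2-fibre product `U ×_X Y` of the morphisms `U → X` and `Y → X`
given by the objects `x` and `y` of `X`: morphisms `T → P` correspond to triples `(a, b, φ)` with
`a : T → U`, `b : T → Y` and an isomorphism `φ : a^* x ≅ b^* y` over `T`. -/
structure FiberProduct {U Y : Scheme.{u}} (x : X.obj ⟨op U⟩) (y : X.obj ⟨op Y⟩) where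
  P : Scheme.{u}
  fst : P ⟶ U
  snd : P ⟶ Y
  iso : (X.map fst.op.toLoc).toFunctor.obj x ≅ (X.map snd.op.toLoc).toFunctor.obj y
  existsUnique_lift : ∀ ⦃T : Scheme.{u}⦄ (a : T ⟶ U) (b : T ⟶ Y)
    (φ : (X.map a.op.toLoc).toFunctor.obj x ≅ (X.map b.op.toLoc).toFunctor.obj y),
    ∃! h : T ⟶ P, ∃ (ha : h ≫ fst = a) (hb : h ≫ snd = b),
      pullHom iso.hom h a b ha hb = φ.hom

/-- The morphism `Y → X` given by the object `y` of `X` over `Y` is representable, surjective and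
finite locally free of constant degree `d`: this holds for its base change to every scheme. -/
def IsFiniteLocallyFreeCover {Y : Scheme.{u}} (y : X.obj ⟨op Y⟩) (d : ℕ) : Prop :=
  ∀ ⦃U : Scheme.{u}⦄ (x : X.obj ⟨op U⟩), ∃ Q : FiberProduct x y,
    Surjective Q.fst ∧ IsFinite Q.fst ∧ Flat Q.fst ∧ LocallyOfFinitePresentation Q.fst ∧
      ∀ s : U, Q.fst.finrank s = d

end Cover

end WellNighAffine

/-!
# Cohomology of well-nigh affine stacks is killed by the degree of a cover

Let `π : Y → X` be a finite locally free cover of degree `d` of a stack by an affine scheme. The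
powers `Y ×_X ⋯ ×_X Y` are affine, and for a quasi-coherent module `F` the Čech complex
`F(Y) → F(Y ×_X Y) → ⋯` computes the cohomology of `X`. Each projection
`Y^{k+2} → Y^{k+1}` forgetting the last component is finite locally free of degree `d`, so that
`F(Y^{k+2})` is the base change of `F(Y^{k+1})` along a finite projective ring homomorphism of rank
`d`. The trace of the latter induces a transfer map `F(Y^{k+2}) → F(Y^{k+1})`
(`IsBaseChange.transfer`). It commutes with base change, hence with the other face maps, and its
composition with the restriction map is multiplication by `d`. Up to a sign it is a homotopy
between `d` and `0` on the Čech complex (`WellNighAffine.IsQuasiCoherent.cechKilled`).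

The comparison between Čech cohomology and derived functor cohomology is avoided: the vanishing
is obtained by dimension shifting in the style of Cartan (`nsmul_cohomology_eq_zero`). Consider
the class of abelian sheaves `G` such that

* every Čech cocycle of positive degree of `G` for an affine faithfully flat covering, locally of
  finite presentation, is a coboundary (`CoveringBasis.IsAcyclic`);
* `d` times every Čech cocycle of positive degree of `G` for the powers of `Y` is a coboundary
  (`PowerSystem.CechKilled`).

Quasi-coherent modules belong to it, the first property being faithfully flat descent
(`WellNighAffine.IsQuasiCoherent.cechKilled_over`). If `0 → G → I → Q → 0` is exact with `I`
injective, then the first property makes `I(W) → Q(W)` surjective for affine `W`, so that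
the Čech complexes form short exact sequences. As the Čech complexes of `I` are exact in positive
degrees, `Q` belongs to the class again. This reduces the claim to `H¹`, where it says that `d`
times a global section of `Q` lifts to `I`: its restriction to `Y` lifts, the lift defines a
Čech `1`-cocycle of `G`, and a `0`-cochain of `G` whose boundary is `d` times it corrects
`d` times the lift.

The values of an injective presheaf `I` are a retract of `W ↦ ∏_{Z → W} I(Z)`, which
gives an elementary contraction of its Čech complexes (`IsCoinducedRetract.cechKilled`).
-/

/-! ### Traces over finite projective modules -/

open TensorProduct in
/-- The trace of an endomorphism of a finite projective module, obtained by contracting the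
corresponding element of `Mᵛ ⊗ M`. (Mathlib's `LinearMap.trace` is zero for modules without a
basis.) -/
noncomputable def Module.projTrace (R M : Type*) [CommRing R] [AddCommGroup M] [Module R M]
    [Module.Finite R M] [Module.Projective R M] : Module.End R M →ₗ[R] R :=
  contractLeft R M ∘ₗ
    (LinearEquiv.ofBijective (dualTensorHom R M M) dualTensorHom_bijective).symm.toLinearMap

section ProjTrace

open TensorProduct

variable {R M : Type*} [CommRing R] [AddCommGroup M] [Module R M]
    [Module.Finite R M] [Module.Projective R M]

lemma Module.projTrace_dualTensorHom (t : Module.Dual R M ⊗[R] M) :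
    projTrace R M (dualTensorHom R M M t) = contractLeft R M t :=
  congrArg (contractLeft R M) ((LinearEquiv.ofBijective (dualTensorHom R M M)
    dualTensorHom_bijective).symm_apply_apply t)

/-- The trace commutes with base change. -/
lemma Module.projTrace_of_isBaseChange {S N : Type*} [CommRing S] [Algebra R S] [AddCommGroup N]
    [Module R N] [Module S N] [IsScalarTower R S N] [Module.Finite S N] [Module.Projective S N]
    {ι : M →ₗ[R] N} (h : IsBaseChange S ι) (φ : Module.End R M) (ψ : Module.End S N)
    (w : ∀ m, ψ (ι m) = ι (φ m)) :
    projTrace S N ψ = algebraMap R S (projTrace R M φ) := by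
  obtain ⟨t, rfl⟩ := (dualTensorHom_bijective (R := R) (M := M) (N := M)).2 φ
  let e (f : Module.Dual R M) : Module.Dual S N := h.lift (Algebra.linearMap R S ∘ₗ f)
  have he (f m) : e f (ι m) = algebraMap R S (f m) := h.lift_eq _ _
  -- an element of `Nᵛ ⊗ N` representing `ψ`, with the expected contraction
  obtain ⟨t', h₁, h₂⟩ : ∃ t' : Module.Dual S N ⊗[S] N,
      (∀ m, dualTensorHom S N N t' (ι m) = ι (dualTensorHom R M M t m)) ∧
        contractLeft S N t' = algebraMap R S (contractLeft R M t) := by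
    clear w
    induction t using TensorProduct.induction_on with
    | zero => exact ⟨0, by simp, by simp⟩
    | tmul f m => exact ⟨e f ⊗ₜ ι m, fun m' ↦ by simp [he], by simp [he]⟩
    | add x y hx hy =>
      obtain ⟨x', hx₁, hx₂⟩ := hx
      obtain ⟨y', hy₁, hy₂⟩ := hy
      exact ⟨x' + y', fun m ↦ by simp [hx₁, hy₁], by simp [hx₂, hy₂]⟩
  have : ψ = dualTensorHom S N N t' := h.algHom_ext _ _ fun m ↦ by rw [w, h₁]
  rw [this, projTrace_dualTensorHom, h₂, projTrace_dualTensorHom]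

lemma Module.projTrace_eq_trace [Module.Free R M] (φ : Module.End R M) :
    projTrace R M φ = LinearMap.trace R M φ := by
  obtain ⟨t, rfl⟩ := (dualTensorHom_bijective (R := R) (M := M) (N := M)).2 φ
  rw [projTrace_dualTensorHom, LinearMap.trace_eq_contract_apply]

/-- The trace of the identity is the rank. This can be checked after localization at the maximal
ideals, where the module is free. -/
lemma Module.projTrace_one_of_rankAtStalk_eq {d : ℕ}
    (hd : ∀ p, Module.rankAtStalk (R := R) M p = d) : projTrace R M 1 = d := by
  refine Module.eq_of_localization_maximal (fun P _ ↦ Localization.AtPrime P)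
    (fun P _ ↦ Algebra.linearMap R (Localization.AtPrime P)) _ _ fun P hP ↦ ?_
  let S := Localization.AtPrime P
  have h : IsBaseChange S (TensorProduct.mk R S M 1) := TensorProduct.isBaseChange R M S
  have : Module.Free S (S ⊗[R] M) := Module.free_of_flat_of_isLocalRing
  have h₁ := projTrace_of_isBaseChange h 1 1 (fun _ ↦ rfl)
  rw [projTrace_eq_trace, LinearMap.trace_one] at h₁
  have h₂ : Module.finrank S (S ⊗[R] M) = d := by
    rw [← hd ⟨P, inferInstance⟩, rankAtStalk_eq_finrank_tensorProduct]
  rw [h₂] at h₁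
  simpa using! h₁.symm

end ProjTrace

/-! ### Transfer for base changes of modules along finite projective algebras -/

section Transfer

variable {A B M N : Type*} [CommRing A] [CommRing B] [Algebra A B]
  [AddCommGroup M] [AddCommGroup N] [Module A M] [Module A N] [Module B N] [IsScalarTower A B N]
  [Module.Finite A B] [Module.Projective A B]

open TensorProduct in
/-- If `N` is the base change of `M` along the finite projective algebra `A → B`, the transfer map
`N → M`, `b ⊗ m ↦ Tr(b) m`. -/
noncomputable def IsBaseChange.transfer {ι : M →ₗ[A] N} (h : IsBaseChange B ι) : N →ₗ[A] M :=
  (TensorProduct.lid A M).toLinearMap ∘ₗ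
    (LinearMap.rTensor M (Module.projTrace A B ∘ₗ (LinearMap.mul A B))) ∘ₗ
    (h.equiv.symm.toLinearMap.restrictScalars A)

lemma IsBaseChange.transfer_smul {ι : M →ₗ[A] N} (h : IsBaseChange B ι) (b : B) (m : M) :
    h.transfer (b • ι m) = Module.projTrace A B (LinearMap.mulLeft A b) • m := by
  have : h.equiv.symm (b • ι m) = b ⊗ₜ m := by rw [← h.equiv_tmul, LinearEquiv.symm_apply_apply]
  simp only [transfer, LinearMap.comp_apply, LinearMap.restrictScalars_apply]
  erw [this]
  simp
  rfl

lemma IsBaseChange.transfer_apply {ι : M →ₗ[A] N} (h : IsBaseChange B ι) {d : ℕ}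
    (hd : ∀ p, Module.rankAtStalk (R := A) B p = d) (m : M) : h.transfer (ι m) = d • m := by
  have := h.transfer_smul 1 m
  rwa [one_smul, LinearMap.mulLeft_one, ← Module.End.one_eq_id,
    Module.projTrace_one_of_rankAtStalk_eq hd, Nat.cast_smul_eq_nsmul] at this

/-- The transfer map commutes with base change. -/
lemma IsBaseChange.transfer_naturality {ι : M →ₗ[A] N} (h : IsBaseChange B ι)
    {A' B' M' N' : Type*} [CommRing A'] [CommRing B'] [Algebra A' B'] [AddCommGroup M']
    [AddCommGroup N'] [Module A' M'] [Module A' N'] [Module B' N'] [IsScalarTower A' B' N']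
    [Module.Finite A' B'] [Module.Projective A' B'] {ι' : M' →ₗ[A'] N'} (h' : IsBaseChange B' ι')
    [Algebra A A'] [Algebra B B'] [Algebra A B'] [IsScalarTower A A' B'] [IsScalarTower A B B']
    [Algebra.IsPushout A A' B B']
    (r : M →+ M') (hr : ∀ (a : A) m, r (a • m) = algebraMap A A' a • r m)
    (s : N →+ N') (hs : ∀ (b : B) n, s (b • n) = algebraMap B B' b • s n)
    (w : ∀ m, s (ι m) = ι' (r m)) (n : N) : h'.transfer (s n) = r (h.transfer n) := by
  obtain ⟨x, rfl⟩ := h.equiv.surjective n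
  induction x using TensorProduct.induction_on with
  | zero => simp
  | tmul b m =>
    have := Module.projTrace_of_isBaseChange (R := A) (M := B) (S := A') (N := B')
      (Algebra.IsPushout.out (R := A) (S := A') (R' := B) (S' := B')) (LinearMap.mulLeft A b)
      (LinearMap.mulLeft A' (algebraMap B B' b)) (fun _ ↦ by simp)
    rw [h.equiv_tmul, hs, w, h.transfer_smul, h'.transfer_smul, hr, this]
  | add x y hx hy => simp [hx, hy]

end Transfer

/-! ### Descent along faithfully flat algebras -/

section Descent

variable {A B M N : Type*} [CommRing A] [CommRing B] [Algebra A B]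
  [AddCommGroup M] [AddCommGroup N] [Module A M] [Module A N] [Module B N] [IsScalarTower A B N]

/-- Membership in a submodule can be tested after a faithfully flat base change. -/
lemma IsBaseChange.mem_of_mem_span [Module.FaithfullyFlat A B] {ι : M →ₗ[A] N}
    (h : IsBaseChange B ι) (S : Submodule A M) (m : M)
    (hm : ι m ∈ Submodule.span B (ι '' S)) : m ∈ S := by
  rw [← Submodule.Quotient.mk_eq_zero,
    ← Module.FaithfullyFlat.one_tmul_eq_zero_iff A (M ⧸ S) (A := B)]
  let q : N →ₗ[B] TensorProduct A B (M ⧸ S) := h.lift (TensorProduct.mk A B (M ⧸ S) 1 ∘ₗ S.mkQ)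
  have hq (m : M) : q (ι m) = 1 ⊗ₜ[A] Submodule.Quotient.mk m := h.lift_eq _ _
  rw [← hq, ← LinearMap.mem_ker]
  refine (Submodule.span_le (p := LinearMap.ker q)).2 ?_ hm
  rintro _ ⟨s, hs, rfl⟩
  simp [hq, (Submodule.Quotient.mk_eq_zero S).2 hs]

/-- If `A' → B'` is the base change of `A → B`, then a base change of an `A'`-module along
`A' → B'` is also its base change along `A → B`. -/
lemma IsBaseChange.of_isPushout (A B : Type*) {A' B' M N : Type*} [CommRing A] [CommRing B]
    [CommRing A'] [CommRing B']
    [Algebra A B] [Algebra A A'] [Algebra A' B'] [Algebra B B'] [Algebra A B']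
    [IsScalarTower A A' B'] [IsScalarTower A B B'] [Algebra.IsPushout A A' B B']
    [AddCommGroup M] [AddCommGroup N] [Module A M] [Module A' M] [IsScalarTower A A' M]
    [Module A N] [Module A' N] [Module B N] [Module B' N] [IsScalarTower A' B' N]
    [IsScalarTower B B' N] [IsScalarTower A B N] [IsScalarTower A A' N]
    {ι : M →ₗ[A'] N} (h : IsBaseChange B' ι) : IsBaseChange B (ι.restrictScalars A) := by
  have : Algebra.IsPushout A B A' B' := Algebra.IsPushout.symm inferInstance
  refine IsBaseChange.of_equiv ((Algebra.IsPushout.cancelBaseChange A B A' B' M).symm ≪≫ₗ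
    h.equiv.restrictScalars B) fun m ↦ ?_
  simp [h.equiv_tmul]

end Descent

/-! ### Čech cochains -/

section Cech

universe w v' u'

variable {D : Type u'} [Category.{v'} D]

/-- A system of powers of an object `V`: for every `k`, an object `pow k` which is a product of
`k + 1` copies of `V`. (There is no power for the empty product, which would be a
terminal object.) -/
structure PowerSystem (V : D) where
  pow : ℕ → D
  pr {k : ℕ} : Fin (k + 1) → (pow k ⟶ V)
  lift {k : ℕ} {W : D} : (Fin (k + 1) → (W ⟶ V)) → (W ⟶ pow k)
  lift_pr {k : ℕ} {W : D} (v : Fin (k + 1) → (W ⟶ V)) (i : Fin (k + 1)) : lift v ≫ pr i = v i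
  hom_ext {k : ℕ} {W : D} (f g : W ⟶ pow k) : (∀ i, f ≫ pr i = g ≫ pr i) → f = g

namespace PowerSystem

attribute [simp] lift_pr

variable {V : D} (P : PowerSystem V) {k : ℕ}

lemma lift_comp {W W' : D} (g : W' ⟶ W) (v : Fin (k + 1) → (W ⟶ V)) :
    g ≫ P.lift v = P.lift fun i ↦ g ≫ v i :=
  P.hom_ext _ _ fun i ↦ by simp

lemma lift_pr_eq_id : P.lift P.pr = 𝟙 (P.pow k) := P.hom_ext _ _ fun i ↦ by simp

lemma lift_comp_pr {W : D} (g : W ⟶ P.pow k) : P.lift (fun i ↦ g ≫ P.pr i) = g := by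
  rw [← lift_comp, lift_pr_eq_id, Category.comp_id]

/-- The face map `V^{k+2} → V^{k+1}` forgetting the `i`-th component. -/
def face (i : Fin (k + 2)) : P.pow (k + 1) ⟶ P.pow k := P.lift fun j ↦ P.pr (i.succAbove j)

/-- The value of a Čech cochain `c ∈ I(V^{k+1})` at a tuple of morphisms `W → V`. -/
def ev (I : Dᵒᵖ ⥤ AddCommGrpCat.{w}) {W : D} (v : Fin (k + 1) → (W ⟶ V)) :
    I.obj (op (P.pow k)) →+ I.obj (op W) := (I.map (P.lift v).op).hom

/-- The Čech differential: the alternating sum of the pullbacks along the face maps. -/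
def δ (I : Dᵒᵖ ⥤ AddCommGrpCat.{w}) (k : ℕ) :
    I.obj (op (P.pow k)) →+ I.obj (op (P.pow (k + 1))) :=
  ∑ i : Fin (k + 2), (-1 : ℤ) ^ (i : ℕ) • (I.map (P.face i).op).hom

section

variable (I : Dᵒᵖ ⥤ AddCommGrpCat.{w})

lemma δ_apply (c : I.obj (op (P.pow k))) :
    P.δ I k c = ∑ i : Fin (k + 2), (-1 : ℤ) ^ (i : ℕ) • I.map (P.face i).op c := by
  simp [δ]

lemma map_ev {W W' : D} (g : W' ⟶ W) (v : Fin (k + 1) → (W ⟶ V)) (c : I.obj (op (P.pow k))) :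
    I.map g.op (P.ev I v c) = P.ev I (fun i ↦ g ≫ v i) c := by
  simp only [ev, ← lift_comp, op_comp, Functor.map_comp]
  rfl

lemma ev_pr (c : I.obj (op (P.pow k))) : P.ev I P.pr c = c := by
  simp [ev, lift_pr_eq_id]

lemma ev_comp_pr {W : D} (g : W ⟶ P.pow k) (c : I.obj (op (P.pow k))) :
    P.ev I (fun i ↦ g ≫ P.pr i) c = I.map g.op c := by
  rw [ev, lift_comp_pr]

lemma ev_δ {W : D} (v : Fin (k + 2) → (W ⟶ V)) (c : I.obj (op (P.pow k))) :
    P.ev I v (P.δ I k c) =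
      ∑ i : Fin (k + 2), (-1 : ℤ) ^ (i : ℕ) • P.ev I (fun j ↦ v (i.succAbove j)) c := by
  rw [δ_apply, map_sum]
  refine Finset.sum_congr rfl fun i _ ↦ ?_
  rw [map_zsmul]
  congr 1
  change I.map (P.lift v).op (P.ev I _ c) = _
  rw [map_ev]
  simp

lemma ev_naturality {I Q : Dᵒᵖ ⥤ AddCommGrpCat.{w}} (β : I ⟶ Q) {W : D}
    (v : Fin (k + 1) → (W ⟶ V)) (c : I.obj (op (P.pow k))) :
    β.app _ (P.ev I v c) = P.ev Q v (β.app _ c) :=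
  congr($(β.naturality (P.lift v).op) c)

lemma δ_naturality {I Q : Dᵒᵖ ⥤ AddCommGrpCat.{w}} (β : I ⟶ Q) (c : I.obj (op (P.pow k))) :
    β.app _ (P.δ I k c) = P.δ Q k (β.app _ c) := by
  rw [δ_apply, δ_apply, map_sum]
  refine Finset.sum_congr rfl fun i _ ↦ ?_
  rw [map_zsmul]
  congr 1
  exact congr($(β.naturality (P.face i).op) c)

lemma δ_δ (c : I.obj (op (P.pow k))) : P.δ I (k + 1) (P.δ I k c) = 0 := by
  rw [← P.ev_pr I (P.δ I (k + 1) _), ev_δ]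
  simp only [ev_δ, Finset.smul_sum, smul_smul, ← pow_add]
  rw [← Fintype.sum_prod_type']
  -- the faces of faces cancel in pairs
  refine Finset.sum_involution (fun p _ ↦ (p.1.succAbove p.2, p.2.predAbove p.1)) ?_ ?_ ?_ ?_
  · rintro ⟨i, j⟩ -
    simp only [Fin.succAbove_succAbove_succAbove_predAbove,
      Fin.neg_one_pow_succAbove_add_predAbove]
    simp
  · rintro ⟨i, j⟩ - - h
    exact Fin.succAbove_ne i j congr($(h).1)
  · simp
  · rintro ⟨i, j⟩ -
    exact Prod.ext (Fin.succAbove_succAbove_predAbove i j) (Fin.predAbove_predAbove_succAbove i j)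

/-- Inserting a fixed component `v₀` contracts a Čech cocycle. -/
lemma sum_ev_cons {c : I.obj (op (P.pow (k + 1)))} (hc : P.δ I (k + 1) c = 0) {W : D}
    (v : Fin (k + 2) → (W ⟶ V)) (v₀ : W ⟶ V) :
    ∑ i : Fin (k + 2), (-1 : ℤ) ^ (i : ℕ) •
      P.ev I (Fin.cons v₀ fun j ↦ v (i.succAbove j) : Fin (k + 2) → (W ⟶ V)) c = P.ev I v c := by
  have h := P.ev_δ I (Fin.cons v₀ v : Fin (k + 3) → (W ⟶ V)) c
  rw [hc, map_zero, Fin.sum_univ_succ] at h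
  have h₁ (i : Fin (k + 2)) : (fun j ↦ (Fin.cons v₀ v : Fin (k + 3) → (W ⟶ V))
      (i.succ.succAbove j)) = Fin.cons v₀ fun j ↦ v (i.succAbove j) := by
    funext j
    refine Fin.cases ?_ (fun j ↦ ?_) j <;> simp
  simp only [h₁, Fin.val_zero, pow_zero, one_smul, Fin.succAbove_zero, Fin.cons_succ, Fin.val_succ,
    pow_succ, mul_neg, mul_one, neg_smul, Finset.sum_neg_distrib] at h
  exact (eq_of_sub_eq_zero ((sub_eq_add_neg _ _).trans h.symm)).symm

/-- Every Čech cocycle of positive degree becomes a coboundary when multiplied by `d`. -/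
def CechKilled (d : ℕ) : Prop :=
  ∀ (k : ℕ) (c : I.obj (op (P.pow (k + 1)))), P.δ I (k + 1) c = 0 →
    ∃ b : I.obj (op (P.pow k)), P.δ I k b = d • c

end

end PowerSystem

/-- A presheaf `I` is a retract of the coinduced presheaf `W ↦ ∏_{Z → W} I(Z)`. -/
def IsCoinducedRetract (I : Dᵒᵖ ⥤ AddCommGrpCat.{w}) : Prop :=
  ∃ r : ∀ W : D, (∀ Z : D, (Z ⟶ W) → I.obj (op Z)) →+ I.obj (op W),
    (∀ ⦃W W' : D⦄ (f : W' ⟶ W) m, I.map f.op (r W m) = r W' fun Z g ↦ m Z (g ≫ f)) ∧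
      ∀ W s, r W (fun _ g ↦ I.map g.op s) = s

/-- The Čech complex of a retract of a coinduced presheaf is exact in positive degrees: the
coinduced presheaf does not see the restriction maps, so that the usual contraction
`(hc)(v₁, …, vₖ) = c(v, v₁, …, vₖ)` can use an arbitrary morphism `v : Z → V` for each `Z`. -/
lemma IsCoinducedRetract.cechKilled {I : Dᵒᵖ ⥤ AddCommGrpCat.{w}} (hI : IsCoinducedRetract I)
    {V : D} (P : PowerSystem V) : P.CechKilled I 1 := by
  classical
  intro k c hc
  obtain ⟨r, hr, hr'⟩ := hI
  -- the chosen morphism `Z → V` depends only on `Z`, not on `v`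
  let m (Z : D) (v : Fin (k + 1) → (Z ⟶ V)) : I.obj (op Z) :=
    P.ev I (Fin.cons (Classical.choice ⟨v 0⟩) v) c
  refine ⟨r _ fun Z g ↦ m Z fun i ↦ g ≫ P.pr i, ?_⟩
  rw [one_smul, P.δ_apply]
  simp only [hr]
  simp only [← map_zsmul, ← map_sum]
  rw [← hr' _ c]
  refine congrArg (r _) (funext fun Z ↦ funext fun g ↦ ?_)
  rw [Finset.sum_apply, Finset.sum_apply, ← P.ev_comp_pr,
    ← P.sum_ev_cons I hc _ (Classical.choice ⟨g ≫ P.pr 0⟩)]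
  refine Finset.sum_congr rfl fun i _ ↦ ?_
  simp only [Pi.smul_apply, PowerSystem.face, Category.assoc, PowerSystem.lift_pr, m]

/-- Čech acyclicity (up to the multiplier `d`) passes to the cokernel of an embedding into a
presheaf which is Čech acyclic, provided that Čech cochains can be lifted along the quotient map. -/
lemma PowerSystem.CechKilled.of_exact {V : D} {P : PowerSystem V} {G I Q : Dᵒᵖ ⥤ AddCommGrpCat.{w}}
    (α : G ⟶ I) (β : I ⟶ Q) {d : ℕ} (hG : P.CechKilled G d) (hI : P.CechKilled I 1)
    (hα : ∀ W, Function.Injective (α.app W)) (hβα : ∀ W g, β.app W (α.app W g) = 0)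
    (hex : ∀ W i, β.app W i = 0 → ∃ g, α.app W g = i)
    (hβ : ∀ k, Function.Surjective (β.app (op (P.pow k)))) : P.CechKilled Q d := by
  intro k c hc
  obtain ⟨c', rfl⟩ := hβ _ c
  rw [← P.δ_naturality] at hc
  obtain ⟨g₀, hg₀⟩ := hex _ _ hc
  obtain ⟨g, hg⟩ := hG _ g₀ (hα _ (by rw [P.δ_naturality, hg₀, P.δ_δ, map_zero]))
  obtain ⟨b, hb⟩ := hI _ (d • c' - α.app _ g) (by
    rw [map_sub, map_nsmul, ← P.δ_naturality, hg, map_nsmul, hg₀, sub_self])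
  exact ⟨β.app _ b, by rw [← P.δ_naturality, hb, one_smul, map_sub, map_nsmul, hβα, sub_zero]⟩

/-- A section of `Q = I / G` that lifts to `I` over `V` lifts to `I` globally after multiplication
by `d`, if `V` covers everything and the Čech 1-cocycles of `V` with values in `G` are coboundaries
up to `d`. -/
lemma exists_lift_nsmul_of_cechKilled {K : GrothendieckTopology D} {V : D} {P : PowerSystem V}
    (hV : ∀ W, ∃ R ∈ K W, ∀ ⦃Z⦄ (f : Z ⟶ W), R f → Nonempty (Z ⟶ V))
    {G I Q : Dᵒᵖ ⥤ AddCommGrpCat.{w}} (hIs : Presieve.IsSheaf K (I ⋙ forget _))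
    (hQs : Presieve.IsSheaf K (Q ⋙ forget _))
    (α : G ⟶ I) (β : I ⟶ Q) {d : ℕ} (hG : P.CechKilled G d)
    (hα : ∀ W, Function.Injective (α.app W)) (hβα : ∀ W g, β.app W (α.app W g) = 0)
    (hex : ∀ W i, β.app W i = 0 → ∃ g, α.app W g = i)
    (q : ∀ W, Q.obj (op W)) (hq : ∀ ⦃W W'⦄ (f : W' ⟶ W), Q.map f.op (q W) = q W')
    (i₀ : I.obj (op V)) (hi₀ : β.app _ i₀ = q V) :
    ∃ i : ∀ W, I.obj (op W), (∀ ⦃W W'⦄ (f : W' ⟶ W), I.map f.op (i W) = i W') ∧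
      ∀ W, β.app _ (i W) = d • q W := by
  -- the image of `i₀` as a cochain of degree zero
  let c : I.obj (op (P.pow 0)) := I.map (P.pr 0).op i₀
  have hc {W : D} (v : Fin 1 → (W ⟶ V)) : P.ev I v c = I.map (v 0).op i₀ := by
    have : v 0 = P.lift v ≫ P.pr 0 := by simp
    rw [this, op_comp, Functor.map_comp]
    rfl
  have hβc : β.app _ (P.δ I 0 c) = 0 := by
    have h₁ : β.app _ c = q _ := by
      rw [← hq (P.pr 0), ← hi₀]
      exact congr($(β.naturality (P.pr 0).op) i₀)
    rw [P.δ_naturality, h₁, P.δ_apply]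
    simp [hq, Fin.sum_univ_two]
  obtain ⟨g₀, hg₀⟩ := hex _ _ hβc
  obtain ⟨g, hg⟩ := hG _ g₀ (hα _ (by rw [P.δ_naturality, hg₀, P.δ_δ, map_zero]))
  let b : I.obj (op (P.pow 0)) := d • c - α.app _ g
  have hb : P.δ I 0 b = 0 := by
    rw [map_sub, map_nsmul, ← P.δ_naturality, hg, map_nsmul, hg₀, sub_self]
  -- the cocycle `b` takes the same value at all morphisms `W → V`
  let j {W : D} (v : W ⟶ V) : I.obj (op W) := P.ev I (fun _ : Fin 1 ↦ v) b
  have hj {W : D} (v v' : W ⟶ V) : j v = j v' := by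
    have h := P.ev_δ I ![v, v'] b
    rw [hb, map_zero, Fin.sum_univ_two] at h
    simp only [Fin.val_zero, pow_zero, one_smul, Fin.val_one, pow_one, neg_smul,
      ← sub_eq_add_neg] at h
    refine (sub_eq_zero.1 ((h.trans ?_).symm)).symm
    congr 2 <;> (congr 1; funext x; fin_cases x; rfl)
  have hjm {W W' : D} (f : W' ⟶ W) (v : W ⟶ V) : I.map f.op (j v) = j (f ≫ v) := P.map_ev ..
  have hβj {W : D} (v : W ⟶ V) : β.app _ (j v) = d • q W := by
    simp only [j, b]
    rw [map_sub, map_nsmul, hc, map_sub, map_nsmul, P.ev_naturality β, hβα, map_zero, sub_zero]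
    congr 1
    rw [← hq v, ← hi₀]
    exact congr($(β.naturality v.op) i₀)
  have glue (W : D) : ∃ i : I.obj (op W), ∀ ⦃Z⦄ (f : Z ⟶ W) (v : Z ⟶ V), I.map f.op i = j v := by
    obtain ⟨R, hR, hRV⟩ := hV W
    let x : Presieve.FamilyOfElements (I ⋙ forget _) R.arrows :=
      fun Z f hf ↦ j (Classical.choice (hRV f hf))
    have hx : x.Compatible := by
      intro Y₁ Y₂ Z g₁ g₂ f₁ f₂ h₁ h₂ w
      exact (hjm _ _).trans ((hj _ _).trans (hjm _ _).symm)
    refine ⟨(hIs R hR).amalgamate x hx, fun Z f v ↦ ?_⟩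
    refine (hIs _ (K.pullback_stable f hR)).isSeparatedFor.ext fun Z' g hg ↦ ?_
    have h₁ := (hIs R hR).valid_glue hx (g ≫ f) hg
    have h₂ : I.map g.op (j v) = j (g ≫ v) := hjm g v
    refine Eq.trans ?_ (h₁.trans ((hj _ _).trans h₂.symm))
    rw [op_comp, Functor.map_comp_apply]
    rfl
  choose i hi using glue
  have hsep {F : Dᵒᵖ ⥤ AddCommGrpCat.{w}} (hF : Presieve.IsSheaf K (F ⋙ forget _)) {W : D}
      (s t : F.obj (op W)) (hst : ∀ ⦃Z⦄ (f : Z ⟶ W), Nonempty (Z ⟶ V) →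
        F.map f.op s = F.map f.op t) : s = t := by
    obtain ⟨R, hR, hRV⟩ := hV W
    exact (hF R hR).isSeparatedFor.ext fun Z f hf ↦ hst f (hRV f hf)
  refine ⟨i, fun W W' f ↦ hsep hIs _ _ fun Z g ⟨v⟩ ↦ ?_, fun W ↦ hsep hQs _ _ fun Z g ⟨v⟩ ↦ ?_⟩
  · rw [hi W' g v, ← hi W (g ≫ f) v, op_comp, Functor.map_comp]
    rfl
  · rw [map_nsmul, hq, ← hβj v, ← hi W g v]
    exact congr($(β.naturality g.op) (i W)).symm

end Cech

/-! ### Injective presheaves and coinduced presheaves -/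

section Coinduced

universe w

variable {C : Type (u + 1)} [Category.{u} C]

/-- The coinduced presheaf `W ↦ ∏_{Z → W} I(Z)`. -/
def coinducedPresheaf (I : Cᵒᵖ ⥤ AddCommGrpCat.{u + 1}) : Cᵒᵖ ⥤ AddCommGrpCat.{u + 1} where
  obj W := .of (∀ Z : C, (Z ⟶ W.unop) → I.obj (op Z))
  map f := AddCommGrpCat.ofHom
    { toFun := fun m Z g ↦ m Z (g ≫ f.unop)
      map_zero' := rfl
      map_add' := fun _ _ ↦ rfl }
  map_id _ := by ext; simp
  map_comp _ _ := by ext; simp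

/-- The embedding of a presheaf into the coinduced presheaf. -/
def toCoinducedPresheaf (I : Cᵒᵖ ⥤ AddCommGrpCat.{u + 1}) : I ⟶ coinducedPresheaf I where
  app W := AddCommGrpCat.ofHom
    { toFun := fun s _ g ↦ I.map g.op s
      map_zero' := by funext; simp
      map_add' := fun _ _ ↦ by funext; simp }
  naturality _ _ f := by
    ext s
    funext Z g
    change I.map g.op (I.map f s) = I.map (g ≫ f.unop).op s
    rw [op_comp, Functor.map_comp]
    rfl

instance (I : Cᵒᵖ ⥤ AddCommGrpCat.{u + 1}) : Mono (toCoinducedPresheaf I) := by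
  refine (NatTrans.mono_iff_mono_app _).2 fun W ↦ (AddCommGrpCat.mono_iff_injective _).2
    fun s t h ↦ ?_
  have : I.map (𝟙 _) s = I.map (𝟙 _) t := congr($h W.unop (𝟙 _))
  simpa using this

lemma IsCoinducedRetract.of_injective (I : Cᵒᵖ ⥤ AddCommGrpCat.{u + 1}) [Injective I] :
    IsCoinducedRetract I := by
  let r : coinducedPresheaf I ⟶ I := Injective.factorThru (𝟙 I) (toCoinducedPresheaf I)
  refine ⟨fun W ↦ (r.app (op W)).hom, fun W W' f m ↦ congr($(r.naturality f.op) m).symm,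
    fun W s ↦ ?_⟩
  exact congr(($(Injective.comp_factorThru (𝟙 I) (toCoinducedPresheaf I)).app (op W)) s)

lemma IsCoinducedRetract.over {D : Type*} [Category* D] {I : Dᵒᵖ ⥤ AddCommGrpCat.{w}}
    (hI : IsCoinducedRetract I) (U : D) : IsCoinducedRetract ((Over.forget U).op ⋙ I) := by
  obtain ⟨r, hr, hr'⟩ := hI
  refine ⟨fun W ↦
    { toFun := fun m ↦ r W.left fun Z g ↦ m (Over.mk (g ≫ W.hom)) (Over.homMk g)
      map_zero' := map_zero (r W.left)
      map_add' := fun m m' ↦ map_add (r W.left) _ _ }, fun W W' f m ↦ ?_, fun W s ↦ hr' W.left s⟩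
  refine (hr f.left _).trans ?_
  refine congrArg (r W'.left) (funext fun Z ↦ funext fun g ↦ ?_)
  have h {a b : Z ⟶ U} (e : a = b) (x : Z ⟶ W.left) (hx : x ≫ W.hom = a) (hx' : x ≫ W.hom = b) :
      (m (Over.mk a) (Over.homMk x hx) : I.obj (op Z)) = m (Over.mk b) (Over.homMk x hx') := by
    subst e; rfl
  exact (h (b := g ≫ W'.hom) ((Category.assoc _ _ _).trans (by rw [Over.w])) _ _
    ((Category.assoc _ _ _).trans (by rw [Over.w]))).trans
    (congrArg (m _) (Over.OverMorphism.ext rfl))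

end Coinduced

/-! ### Čech vanishing implies vanishing of cohomology up to a multiplier -/

section Site

universe w'

variable {C : Type (u + 1)} [Category.{u} C] {J : GrothendieckTopology C}

variable (J) in
/-- A class of objects `aff` (the "affine" ones) of a site and a class `Cov` of covering morphisms
whose powers are affine, such that covering sieves of affine objects can be refined by members of
`Cov`, up to disjoint unions. -/
structure CoveringBasis where
  /-- The affine objects. -/
  aff : C → Prop
  /-- The distinguished covering morphisms. -/
  Cov : ∀ ⦃V U : C⦄, (V ⟶ U) → Prop
  powers : ∀ ⦃V U : C⦄ (p : V ⟶ U), Cov p → PowerSystem (Over.mk p)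
  aff_powers : ∀ ⦃V U : C⦄ (p : V ⟶ U) (hp : Cov p) (k : ℕ), aff ((powers p hp).pow k).left
  mem : ∀ ⦃V U : C⦄ (p : V ⟶ U), Cov p → Sieve.generate (Presieve.singleton p) ∈ J U
  refine : ∀ ⦃U : C⦄, aff U → ∀ R ∈ J U, ∃ (V : C) (p : V ⟶ U), Cov p ∧
    ∃ (ι : Type u) (X : ι → C) (s : ∀ i, X i ⟶ V), Sieve.ofArrows X s ∈ J V ∧
      (∀ i, Mono (s i)) ∧ (∀ i, R (s i ≫ p)) ∧
      ∀ ⦃i j : ι⦄ ⦃Z : C⦄ (a : Z ⟶ X i) (b : Z ⟶ X j), i ≠ j → a ≫ s i = b ≫ s j → ⊥ ∈ J Z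

/-- A sheaf is Čech acyclic if positive degree Čech cocycles of all distinguished coverings are
coboundaries. -/
def CoveringBasis.IsAcyclic (B : CoveringBasis J) (G : Sheaf J AddCommGrpCat.{u + 1}) : Prop :=
  ∀ ⦃V U : C⦄ (p : V ⟶ U) (hp : B.Cov p),
    (B.powers p hp).CechKilled ((Over.forget U).op ⋙ G.obj) 1

lemma isSheaf_comp_forget (G : Sheaf J AddCommGrpCat.{u + 1}) :
    Presieve.IsSheaf J (G.obj ⋙ forget _) :=
  (isSheaf_iff_isSheaf_of_type _ _).1
    ((Presheaf.isSheaf_iff_isSheaf_forget J G.obj (forget AddCommGrpCat)).1 G.property)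

section ShortExact

variable {S : ShortComplex (Sheaf J AddCommGrpCat.{u + 1})}

lemma app_app_eq_zero (W : Cᵒᵖ) (g : S.X₁.obj.obj W) : S.g.hom.app W (S.f.hom.app W g) = 0 :=
  congr(($(S.zero).hom.app W) g)

variable [HasSheafify J AddCommGrpCat.{u + 1}]

lemma app_injective_of_shortExact (hS : S.ShortExact) (W : Cᵒᵖ) :
    Function.Injective (S.f.hom.app W) := by
  have := hS.mono_f
  have : Mono ((sheafToPresheaf J AddCommGrpCat.{u + 1}).map S.f) := inferInstance
  exact (AddCommGrpCat.mono_iff_injective _).1 ((NatTrans.mono_iff_mono_app _).1 this W)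

lemma exists_app_eq_of_shortExact (hS : S.ShortExact) (W : Cᵒᵖ) (i : S.X₂.obj.obj W)
    (hi : S.g.hom.app W i = 0) : ∃ g, S.f.hom.app W g = i := by
  have := hS.mono_f
  let F := sheafToPresheaf J AddCommGrpCat.{u + 1} ⋙ (evaluation _ _).obj W
  have h := hS.exact.map_of_mono_of_preservesKernel F inferInstance inferInstance
  rw [ShortComplex.ab_exact_iff] at h
  exact h i hi

/-- Sections over affine objects can be lifted to an extension by a Čech acyclic sheaf. -/
lemma CoveringBasis.IsAcyclic.app_surjective {B : CoveringBasis J} (hS : S.ShortExact)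
    (hG : B.IsAcyclic S.X₁) {U : C} (hU : B.aff U) :
    Function.Surjective (S.g.hom.app (op U)) := by
  intro q
  have := hS.epi_g
  have hs : Sheaf.IsLocallySurjective S.g := (Sheaf.isLocallySurjective_iff_epi' _ S.g).2 hS.epi_g
  obtain ⟨V, p, hp, ι, X, s, hs, hm, hR, hd⟩ := B.refine hU _ (hs.imageSieve_mem q)
  -- the restriction of `q` to the disjoint union `V` of the `X i` can be lifted
  obtain ⟨i₀, hi₀⟩ : ∃ i₀ : S.X₂.obj.obj (op V), S.g.hom.app _ i₀ = S.X₃.obj.map p.op q := by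
    choose t ht using hR
    have ht' (i : ι) : S.g.hom.app _ (t i) = S.X₃.obj.map (s i ≫ p).op q := ht i
    have hX {i j : ι} {Z : C} (a : Z ⟶ X i) (b : Z ⟶ X j) (w : a ≫ s i = b ≫ s j) :
        S.X₂.obj.map a.op (t i) = S.X₂.obj.map b.op (t j) := by
      by_cases hij : i = j
      · subst hij
        rw [(cancel_mono (s i)).1 w]
      · exact (isSheaf_comp_forget S.X₂ _ (hd a b hij w)).isSeparatedFor.ext fun _ _ h ↦ h.elim
    obtain ⟨i₀, h₀, -⟩ := (Presieve.isSheafFor_arrows_iff _ _).1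
      ((Presieve.isSheafFor_iff_generate _).2 (isSheaf_comp_forget S.X₂ _ hs)) t
      fun i j Z a b w ↦ hX a b w
    refine ⟨i₀, ((Presieve.isSheafFor_iff_generate _).2
      (isSheaf_comp_forget S.X₃ _ hs)).isSeparatedFor.ext ?_⟩
    rintro _ _ ⟨i⟩
    have h₁ : S.X₂.obj.map (s i).op i₀ = t i := h₀ i
    have h₂ := congr($(S.g.hom.naturality (s i).op) i₀)
    refine h₂.symm.trans ((congrArg (S.g.hom.app _) h₁).trans ((ht' i).trans ?_))
    rw [op_comp, Functor.map_comp]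
    rfl
  have h := exists_lift_nsmul_of_cechKilled (K := J.over U) (P := B.powers p hp)
    (G := (Over.forget U).op ⋙ S.X₁.obj) (I := (Over.forget U).op ⋙ S.X₂.obj)
    (Q := (Over.forget U).op ⋙ S.X₃.obj) (d := 1) ?_ (isSheaf_comp_forget (S.X₂.over U))
    (isSheaf_comp_forget (S.X₃.over U))
    (Functor.whiskerLeft _ S.f.hom) (Functor.whiskerLeft _ S.g.hom) (hG p hp)
    (fun W ↦ app_injective_of_shortExact hS _) (fun W ↦ app_app_eq_zero _)
    (fun W ↦ exists_app_eq_of_shortExact hS _) (fun W ↦ S.X₃.obj.map W.hom.op q) ?_ i₀ hi₀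
  · obtain ⟨i, -, hi⟩ := h
    exact ⟨i (Over.mk (𝟙 U)), (hi (Over.mk (𝟙 U))).trans ((one_smul ℕ _).trans (by simp))⟩
  · intro W
    refine ⟨(Sieve.overEquiv W).symm (Sieve.pullback W.hom (Sieve.generate (Presieve.singleton p))),
      ?_, ?_⟩
    · exact J.overEquiv_symm_mem_over _ _ (J.pullback_stable _ (B.mem p hp))
    · rintro Z f hf
      rw [Sieve.overEquiv_symm_iff] at hf
      obtain ⟨_, a, _, ⟨⟩, w⟩ := hf
      exact ⟨Over.homMk a (w.trans (Over.w f))⟩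
  · intro W W' f
    rw [← Over.w f, op_comp, Functor.map_comp]
    rfl

/-- Čech acyclicity passes to the quotient of an injective sheaf by a Čech acyclic sheaf. -/
lemma CoveringBasis.IsAcyclic.of_shortExact {B : CoveringBasis J} (hS : S.ShortExact)
    (hI : IsCoinducedRetract S.X₂.obj) (hG : B.IsAcyclic S.X₁) : B.IsAcyclic S.X₃ :=
  fun _ U p hp ↦ (hG p hp).of_exact
    (Functor.whiskerLeft _ S.f.hom) (Functor.whiskerLeft _ S.g.hom) ((hI.over U).cechKilled _)
    (fun _ ↦ app_injective_of_shortExact hS _) (fun _ ↦ app_app_eq_zero _)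
    (fun _ ↦ exists_app_eq_of_shortExact hS _)
    (fun k ↦ hG.app_surjective hS (B.aff_powers p hp k))

lemma isCoinducedRetract_of_injective (I : Sheaf J AddCommGrpCat.{u + 1}) [Injective I] :
    IsCoinducedRetract I.obj := by
  have : Injective ((sheafToPresheaf J AddCommGrpCat.{u + 1}).obj I) :=
    Injective.injective_of_adjoint (sheafificationAdjunction J _) I
  have : Injective I.obj := this
  exact IsCoinducedRetract.of_injective I.obj

variable {y : C} (P : PowerSystem y)

/-- Global sections, up to a multiplier, lift to an extension by a Čech acyclic sheaf. Global
sections are encoded as morphisms from the constant sheaf `ℤ`, as in the definition of `Sheaf.H`. -/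
lemma exists_comp_eq_nsmul {B : CoveringBasis J} (hS : S.ShortExact)
    (hG : B.IsAcyclic S.X₁) {d : ℕ} (hP : P.CechKilled S.X₁.obj d) (hy : B.aff y)
    (hV : ∀ W, ∃ R ∈ J W, ∀ ⦃Z⦄ (f : Z ⟶ W), R f → Nonempty (Z ⟶ y))
    (h : (constantSheaf J AddCommGrpCat.{u + 1}).obj (.of (ULift ℤ)) ⟶ S.X₃) :
    ∃ i, i ≫ S.g = d • h := by
  let e (G : Sheaf J AddCommGrpCat.{u + 1}) :=
    (sheafificationAdjunction J AddCommGrpCat.{u + 1}).homEquiv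
      ((Functor.const _).obj (.of (ULift ℤ))) G
  obtain ⟨q, rfl⟩ := (e _).symm.surjective h
  obtain ⟨i₀, hi₀⟩ := hG.app_surjective hS hy (q.app _ ⟨1⟩)
  obtain ⟨i, hi, hi'⟩ := exists_lift_nsmul_of_cechKilled (K := J) (P := P) hV
    (isSheaf_comp_forget S.X₂) (isSheaf_comp_forget S.X₃) S.f.hom S.g.hom hP
    (fun W ↦ app_injective_of_shortExact hS _) (fun W ↦ app_app_eq_zero _)
    (fun W ↦ exists_app_eq_of_shortExact hS _) (fun W ↦ q.app (op W) ⟨1⟩)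
    (fun W W' f ↦ congr($(q.naturality f.op) ⟨1⟩).symm) i₀ hi₀
  let i' : (Functor.const _).obj (.of (ULift ℤ)) ⟶ S.X₂.obj :=
    { app := fun W ↦ AddCommGrpCat.ofHom
        ((zmultiplesHom _ (i W.unop)).comp AddEquiv.ulift.toAddMonoidHom)
      naturality := fun W W' f ↦ by
        ext n
        have := hi f.unop
        simp at this
        simp [this] }
  refine ⟨(e _).symm i', ?_⟩
  have : i' ≫ S.g.hom = d • q := by
    ext W ⟨n⟩
    have h₁ := hi' W.unop
    simp at h₁
    have h₂ : q.app W ⟨n⟩ = n • q.app W ⟨1⟩ := by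
      rw [← map_zsmul]
      congr 1
      exact ULift.ext _ _ (by simp)
    simp [i', h₁, h₂]
    exact smul_comm _ _ _
  refine ((e S.X₃).injective ?_)
  refine ((sheafificationAdjunction J AddCommGrpCat.{u + 1}).homEquiv_naturality_right _ _).trans ?_
  have h₁ : e S.X₃ (d • (e S.X₃).symm q) = d • e S.X₃ ((e S.X₃).symm q) :=
    map_nsmul ((sheafificationAdjunction J AddCommGrpCat.{u + 1}).homAddEquiv _ _) d _
  have h₂ : e S.X₂ ((e S.X₂).symm i') ≫ S.g.hom = d • e S.X₃ ((e S.X₃).symm q) := by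
    rw [Equiv.apply_symm_apply, Equiv.apply_symm_apply, this]
  exact h₂.trans h₁.symm

end ShortExact

open Abelian in
/-- Cohomology is killed by `d` in positive degrees if the sheaf is Čech acyclic for the
distinguished coverings and Čech cohomology of the covering `y` of the terminal sheaf is killed by
`d`. The proof is by dimension shifting along an embedding into an injective sheaf. -/
theorem nsmul_cohomology_eq_zero [HasSheafify J AddCommGrpCat.{u + 1}]
    [HasExt.{w'} (Sheaf J AddCommGrpCat.{u + 1})] [EnoughInjectives (Sheaf J AddCommGrpCat.{u + 1})]
    {B : CoveringBasis J} {y : C} (P : PowerSystem y) (hPa : ∀ k, B.aff (P.pow k)) (hy : B.aff y)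
    (hV : ∀ W, ∃ R ∈ J W, ∀ ⦃Z⦄ (f : Z ⟶ W), R f → Nonempty (Z ⟶ y)) {d : ℕ} (n : ℕ) :
    ∀ (G : Sheaf J AddCommGrpCat.{u + 1}), B.IsAcyclic G → P.CechKilled G.obj d →
      ∀ ξ : G.H (n + 1), d • ξ = 0 := by
  induction n with
  | zero =>
    intro G hG hP ξ
    let S := ShortComplex.mk _ _ (Limits.cokernel.condition (Injective.ι G))
    have hS : S.ShortExact := { exact := ShortComplex.exact_cokernel _ }
    obtain ⟨q, rfl⟩ := Ext.covariant_sequence_exact₁ _ hS ξ (Ext.eq_zero_of_injective _) rfl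
    obtain ⟨q, rfl⟩ := (Ext.mk₀_bijective _ _).2 q
    obtain ⟨i, hi⟩ := exists_comp_eq_nsmul P hS hG hP hy hV q
    have h₁ : Ext.mk₀ (d • q) = d • Ext.mk₀ q :=
      map_nsmul (AddMonoidHom.mk' (Ext.mk₀ (X := (constantSheaf J AddCommGrpCat.{u + 1}).obj
        (.of (ULift ℤ)))) Ext.mk₀_add) d q
    have h₂ : d • (Ext.mk₀ q).comp hS.extClass (zero_add 1) =
        (Ext.mk₀ (d • q)).comp hS.extClass (zero_add 1) := by
      rw [h₁]
      exact (map_nsmul (hS.extClass.postcomp _ (zero_add 1)) d (Ext.mk₀ q)).symm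
    refine h₂.trans ?_
    rw [← hi, ← Ext.mk₀_comp_mk₀, Ext.comp_assoc _ _ _ (zero_add 0) (zero_add 1) (by rfl)]
    have h₃ := hS.comp_extClass
    dsimp only [S] at h₃ ⊢
    rw [h₃, Ext.comp_zero]
  | succ n ih =>
    intro G hG hP ξ
    let S := ShortComplex.mk _ _ (Limits.cokernel.condition (Injective.ι G))
    have hS : S.ShortExact := { exact := ShortComplex.exact_cokernel _ }
    obtain ⟨q, rfl⟩ := Ext.covariant_sequence_exact₁ _ hS ξ (Ext.eq_zero_of_injective _) rfl
    have hI : IsCoinducedRetract S.X₂.obj := isCoinducedRetract_of_injective (Injective.under G)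
    have := ih S.X₃ (hG.of_shortExact hS hI) (hP.of_exact S.f.hom S.g.hom (hI.cechKilled _)
      (fun _ ↦ app_injective_of_shortExact hS _) (fun _ ↦ app_app_eq_zero _)
      (fun _ ↦ exists_app_eq_of_shortExact hS _) (fun k ↦ hG.app_surjective hS (hPa k))) q
    refine (map_nsmul (hS.extClass.postcomp _ (rfl : n + 1 + 1 = n + 1 + 1)) d q).symm.trans ?_
    rw [this, map_zero]

end Site

/-! ### Construction of powers -/

section Products

universe v' u'

variable {D : Type u'} [Category.{v'} D]

/-- The morphisms `a` and `b` exhibit `P` as a product of `W` and `V`. -/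
def IsProductCone {P W V : D} (a : P ⟶ W) (b : P ⟶ V) : Prop :=
  ∀ ⦃Z : D⦄ (f : Z ⟶ W) (g : Z ⟶ V), ∃! h : Z ⟶ P, h ≫ a = f ∧ h ≫ b = g

lemma IsProductCone.hom_ext {P W V : D} {a : P ⟶ W} {b : P ⟶ V} (h : IsProductCone a b) {Z : D}
    {k k' : Z ⟶ P} (ha : k ≫ a = k' ≫ a) (hb : k ≫ b = k' ≫ b) : k = k' :=
  (h (k' ≫ a) (k' ≫ b)).unique ⟨ha, hb⟩ ⟨rfl, rfl⟩

lemma PowerSystem.isProductCone {V : D} (P : PowerSystem V) (k : ℕ) :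
    IsProductCone (P.face (Fin.last (k + 1))) (P.pr (Fin.last (k + 1))) := by
  intro Z f g
  refine ⟨P.lift (Fin.snoc (fun i ↦ f ≫ P.pr i) g : Fin (k + 2) → (Z ⟶ V)), ⟨?_, ?_⟩, ?_⟩
  · refine P.hom_ext _ _ fun i ↦ ?_
    simp [face]
  · simp
  · rintro h ⟨rfl, rfl⟩
    refine P.hom_ext _ _ fun i ↦ ?_
    refine Fin.lastCases ?_ (fun i ↦ ?_) i <;> simp [face]

lemma PowerSystem.face_castSucc_comp_face_last {V : D} (P : PowerSystem V) {k : ℕ}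
    (i : Fin (k + 2)) :
    P.face i.castSucc ≫ P.face (Fin.last (k + 1)) = P.face (Fin.last (k + 2)) ≫ P.face i :=
  P.hom_ext _ _ fun j ↦ by simp [face]

lemma PowerSystem.face_castSucc_comp_pr_last {V : D} (P : PowerSystem V) {k : ℕ}
    (i : Fin (k + 2)) :
    P.face i.castSucc ≫ P.pr (Fin.last (k + 1)) = P.pr (Fin.last (k + 2)) := by
  simp [face]

/-- The object `V^{k+2}` is the product of `V^{k+1}` and `V`, compatibly with the face maps. -/
lemma PowerSystem.isPullback_face {V : D} (P : PowerSystem V) (k : ℕ) (i : Fin (k + 2)) :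
    IsPullback (P.face i.castSucc) (P.face (Fin.last (k + 2))) (P.face (Fin.last (k + 1)))
      (P.face i) := by
  refine ⟨⟨P.face_castSucc_comp_face_last i⟩, ⟨Limits.PullbackCone.IsLimit.mk _ ?_ ?_ ?_ ?_⟩⟩
  · exact fun s ↦ (P.isProductCone (k + 1) s.snd (s.fst ≫ P.pr (Fin.last _))).choose
  · intro s
    obtain ⟨h₁, h₂⟩ := (P.isProductCone (k + 1) s.snd (s.fst ≫ P.pr (Fin.last _))).choose_spec.1
    refine (P.isProductCone k).hom_ext ?_ ?_
    · rw [Category.assoc, P.face_castSucc_comp_face_last, reassoc_of% h₁, s.condition]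
    · rw [Category.assoc, P.face_castSucc_comp_pr_last, h₂]
  · exact fun s ↦
      (P.isProductCone (k + 1) s.snd (s.fst ≫ P.pr (Fin.last _))).choose_spec.1.1
  · intro s m h₁ h₂
    refine (P.isProductCone (k + 1) s.snd (s.fst ≫ P.pr (Fin.last _))).unique ⟨h₂, ?_⟩
      (P.isProductCone (k + 1) s.snd (s.fst ≫ P.pr (Fin.last _))).choose_spec.1
    rw [← h₁, Category.assoc, P.face_castSucc_comp_pr_last]

/-- A product of `k + 1` copies of `V` satisfying a predicate, used to construct powers
recursively. -/
structure PowerCone (aff : D → Prop) (V : D) (k : ℕ) where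
  pow : D
  mem : aff pow
  pr : Fin (k + 1) → (pow ⟶ V)
  existsUnique_lift {W : D} (v : Fin (k + 1) → (W ⟶ V)) : ∃! h : W ⟶ pow, ∀ i, h ≫ pr i = v i

/-- The powers of an object exist if its products with all objects of a class exist in that
class. -/
lemma exists_powerSystem {aff : D → Prop} {V : D} (hV : aff V)
    (h : ∀ W, aff W → ∃ (P : D) (a : P ⟶ W) (b : P ⟶ V), aff P ∧ IsProductCone a b) :
    ∃ P : PowerSystem V, ∀ k, aff (P.pow k) := by
  have next {k : ℕ} (Q : PowerCone aff V k) : Nonempty (PowerCone aff V (k + 1)) := by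
    obtain ⟨P, a, b, hP, hab⟩ := h Q.pow Q.mem
    refine ⟨P, hP, Fin.snoc (fun i ↦ a ≫ Q.pr i) b, fun v ↦ ?_⟩
    obtain ⟨g, hg, hg'⟩ := Q.existsUnique_lift fun i ↦ v i.castSucc
    obtain ⟨l, ⟨hl₁, hl₂⟩, hl'⟩ := hab g (v (Fin.last _))
    refine ⟨l, fun i ↦ ?_, fun l' h' ↦ hl' l' ⟨?_, ?_⟩⟩
    · refine Fin.lastCases (by simpa using hl₂) (fun i ↦ ?_) i
      simpa [reassoc_of% hl₁] using hg i
    · exact hg' _ fun i ↦ by simpa using h' i.castSucc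
    · simpa using h' (Fin.last _)
  let Q₀ : PowerCone aff V 0 := ⟨V, hV, fun _ ↦ 𝟙 V, fun v ↦ ⟨v 0, fun i ↦ by
    obtain rfl : i = 0 := Fin.fin_one_eq_zero i
    simp, fun l hl ↦ by simpa using hl 0⟩⟩
  let Q (k : ℕ) : PowerCone aff V k := Nat.rec Q₀ (fun _ q ↦ Classical.choice (next q)) k
  exact ⟨{  pow := fun k ↦ (Q k).pow
            pr := fun {k} ↦ (Q k).pr
            lift := fun {k} _ v ↦ ((Q k).existsUnique_lift v).choose
            lift_pr := fun {k} _ v ↦ ((Q k).existsUnique_lift v).choose_spec.1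
            hom_ext := fun {k} _ f g h ↦
              ((Q k).existsUnique_lift fun i ↦ g ≫ (Q k).pr i).unique h fun _ ↦ rfl },
    fun k ↦ (Q k).mem⟩

/-- A pullback square is a product in the category over its base. -/
lemma CategoryTheory.IsPullback.isProductCone {P W V U : D} {a : P ⟶ W} {b : P ⟶ V}
    {w : W ⟶ U} {v : V ⟶ U} (h : IsPullback a b w v) :
    IsProductCone (Over.homMk a rfl : Over.mk (a ≫ w) ⟶ Over.mk w)
      (Over.homMk b h.w.symm : Over.mk (a ≫ w) ⟶ Over.mk v) := by
  intro Z f g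
  refine ⟨Over.homMk (h.lift f.left g.left ((Over.w f).trans (Over.w g).symm)) ?_, ⟨?_, ?_⟩, ?_⟩
  · exact (h.lift_fst_assoc ..).trans (Over.w f)
  · exact Over.OverMorphism.ext (h.lift_fst ..)
  · exact Over.OverMorphism.ext (h.lift_snd ..)
  · rintro k ⟨rfl, rfl⟩
    exact Over.OverMorphism.ext (h.hom_ext (h.lift_fst ..).symm (h.lift_snd ..).symm)

/-- A product in the category over `U` is a fibre product over `U`. -/
lemma IsProductCone.isPullback {U : D} {P W V : Over U} {a : P ⟶ W} {b : P ⟶ V}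
    (h : IsProductCone a b) : IsPullback a.left b.left W.hom V.hom := by
  refine ⟨⟨(Over.w a).trans (Over.w b).symm⟩, ⟨Limits.PullbackCone.IsLimit.mk _ ?_ ?_ ?_ ?_⟩⟩
  · exact fun s ↦ (h (Z := Over.mk (s.fst ≫ W.hom)) (Over.homMk s.fst)
      (Over.homMk s.snd s.condition.symm)).choose.left
  · exact fun s ↦ congr(($((h (Z := Over.mk (s.fst ≫ W.hom)) (Over.homMk s.fst)
      (Over.homMk s.snd s.condition.symm)).choose_spec.1.1)).left)
  · exact fun s ↦ congr(($((h (Z := Over.mk (s.fst ≫ W.hom)) (Over.homMk s.fst)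
      (Over.homMk s.snd s.condition.symm)).choose_spec.1.2)).left)
  · intro s m h₁ h₂
    let m' : Over.mk (s.fst ≫ W.hom) ⟶ P := Over.homMk m (by
      rw [← Over.w a, reassoc_of% h₁]; rfl)
    exact congr(($((h (Z := Over.mk (s.fst ≫ W.hom)) (Over.homMk s.fst)
      (Over.homMk s.snd s.condition.symm)).unique (y₁ := m')
      ⟨Over.OverMorphism.ext h₁, Over.OverMorphism.ext h₂⟩
      (h (Z := Over.mk (s.fst ≫ W.hom)) (Over.homMk s.fst)
      (Over.homMk s.snd s.condition.symm)).choose_spec.1)).left)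

end Products

/-! ### Affine refinements of fppf coverings -/

open Limits in
/-- A covering sieve of an affine scheme for the fppf topology contains a finite family of affine
schemes whose disjoint union is faithfully flat and locally of finite presentation. -/
lemma exists_affine_refinement_fppf {U : Scheme.{u}} [IsAffine U] {R : Sieve U}
    (hR : R ∈ Scheme.fppfTopology.{u} U) :
    ∃ (ι : Type u) (_ : Finite ι) (X : ι → Scheme.{u}) (f : ∀ i, X i ⟶ U), (∀ i, IsAffine (X i)) ∧
      (∀ i, R (f i)) ∧ Flat (Sigma.desc f) ∧ LocallyOfFinitePresentation (Sigma.desc f) ∧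
      Surjective (Sigma.desc f) := by
  have : Scheme.fppfPrecoverage.{u}.HasIsos :=
    ⟨fun f _ ↦ Scheme.Hom.singleton_mem_fppfPrecoverage f⟩
  obtain ⟨K, hK, hKR⟩ := Precoverage.mem_toGrothendieck_iff_of_isStableUnderComposition.1 hR
  obtain ⟨𝒰, rfl⟩ := (Precoverage.mem_iff_exists_zeroHypercover).1 hK
  let P : MorphismProperty Scheme.{u} := @Flat ⊓ @LocallyOfFinitePresentation
  let 𝒰' : Scheme.Cover (Scheme.precoverage P) U := 𝒰
  -- flat morphisms locally of finite presentation are open, so that finitely many affine opens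
  -- of the members cover `U`
  have : QuasiCompactCover 𝒰'.toPreZeroHypercover :=
    QuasiCompactCover.of_isOpenMap fun i ↦ by
      obtain ⟨_, _⟩ := 𝒰'.map_prop i
      exact (𝒰'.f i).isOpenMap
  have : P.RespectsLeft @IsOpenImmersion := ⟨fun i hi f ⟨_, _⟩ ↦ by
    have : IsOpenImmersion i := hi
    exact ⟨inferInstance, inferInstance⟩⟩
  obtain ⟨𝒱, g, hfin, -⟩ := QuasiCompactCover.exists_hom 𝒰'
  obtain ⟨n, ⟨e⟩⟩ := Finite.exists_equiv_fin 𝒱.I₀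
  -- the index type of `𝒱` lives in the next universe, but it is finite
  let f (i : ULift.{u} (Fin n)) : Spec (𝒱.X (e.symm i.down)) ⟶ U := 𝒱.f _
  have hflat (i) : Flat (f i) := (𝒱.map_prop _).1
  have hlofp (i) : LocallyOfFinitePresentation (f i) := (𝒱.map_prop _).2
  have hι (i) : Sigma.ι (fun i : ULift.{u} (Fin n) ↦ Spec (𝒱.X (e.symm i.down))) i ≫
      Sigma.desc f = f i := Sigma.ι_desc _ _
  refine ⟨_, inferInstance, _, f, fun i ↦ inferInstance, fun i ↦ ?_, ?_, ?_, ⟨fun x ↦ ?_⟩⟩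
  · have h := R.downward_closed (hKR _ _ (Presieve.ofArrows.mk _)) (g.h₀ (e.symm i.down))
    have w : g.h₀ (e.symm i.down) ≫ 𝒰.f _ = f i := g.w₀ (e.symm i.down)
    exact w ▸ h
  · have := HasRingHomProperty.instIsZariskiLocalAtSource (P := @Flat.{u})
    refine (IsZariskiLocalAtSource.iff_of_openCover (P := @Flat)
      (sigmaOpenCover fun i : ULift.{u} (Fin n) ↦ Spec (𝒱.X (e.symm i.down)))).2 fun i ↦ ?_
    exact (hι i).symm ▸ hflat i
  · have := HasRingHomProperty.instIsZariskiLocalAtSource (P := @LocallyOfFinitePresentation.{u})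
    refine (IsZariskiLocalAtSource.iff_of_openCover (P := @LocallyOfFinitePresentation)
      (sigmaOpenCover fun i : ULift.{u} (Fin n) ↦ Spec (𝒱.X (e.symm i.down)))).2 fun i ↦ ?_
    exact (hι i).symm ▸ hlofp i
  · obtain ⟨j, y, rfl⟩ : ∃ j y, 𝒱.f j y = x := ⟨_, 𝒱.covers x⟩
    obtain ⟨i, rfl⟩ := e.symm.surjective j
    refine ⟨Sigma.ι (fun i : ULift.{u} (Fin n) ↦ Spec (𝒱.X (e.symm i.down))) ⟨i⟩ y, ?_⟩
    rw [← Scheme.Hom.comp_apply, hι]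

namespace WellNighAffine

/-! ### Limits in the total category of a stack -/

section TotalCategory

variable {X : FiberedCat.{u}}

/-- A `2`-fibre product, viewed as an object of the total category. -/
def FiberProduct.obj {x y : CoGrothendieck X} (Q : FiberProduct x.fiber y.fiber) :
    CoGrothendieck X :=
  ⟨Q.P, (X.map Q.fst.op.toLoc).toFunctor.obj x.fiber⟩

/-- The first projection of a `2`-fibre product in the total category. -/
def FiberProduct.toFst {x y : CoGrothendieck X} (Q : FiberProduct x.fiber y.fiber) : Q.obj ⟶ x :=
  ⟨Q.fst, 𝟙 _⟩

/-- The second projection of a `2`-fibre product in the total category. -/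
def FiberProduct.toSnd {x y : CoGrothendieck X} (Q : FiberProduct x.fiber y.fiber) : Q.obj ⟶ y :=
  ⟨Q.snd, Q.iso.hom⟩

/-- For a morphism `k` to the `2`-fibre product, the isomorphism between the pullbacks of `x` and
`y` that corresponds to `k` identifies the two components of `k`. -/
lemma FiberProduct.fiber_comp_pullHom {x y z : CoGrothendieck X}
    (Q : FiberProduct x.fiber y.fiber) {k : z ⟶ Q.obj} {f : z ⟶ x} {g : z ⟶ y}
    (hf : k ≫ Q.toFst = f) (hg : k ≫ Q.toSnd = g) :
    f.fiber ≫ pullHom Q.iso.hom k.base f.base g.base congr(($hf).base) congr(($hg).base) =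
      g.fiber := by
  subst hf hg
  obtain ⟨h, kf⟩ := k
  have e : (X.mapComp Q.fst.op.toLoc h.op.toLoc).inv.toNatTrans.app x.fiber ≫
      (X.mapComp Q.fst.op.toLoc h.op.toLoc).hom.toNatTrans.app x.fiber = 𝟙 _ := by
    rw [← Cat.Hom₂.comp_app, Iso.inv_hom_id]; rfl
  have h1 : (X.map h.op.toLoc).toFunctor.map (𝟙 ((X.map Q.fst.op.toLoc).toFunctor.obj x.fiber))
    = 𝟙 _ := CategoryTheory.Functor.map_id _ _
  have e₁ : X.mapComp' Q.fst.op.toLoc h.op.toLoc (h ≫ Q.fst).op.toLoc =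
    X.mapComp Q.fst.op.toLoc h.op.toLoc := X.mapComp'_eq_mapComp _ _
  have e₂ : X.mapComp' Q.snd.op.toLoc h.op.toLoc (h ≫ Q.snd).op.toLoc =
    X.mapComp Q.snd.op.toLoc h.op.toLoc := X.mapComp'_eq_mapComp _ _
  have key {A B C D D' : X.obj ⟨op z.base⟩} {k : A ⟶ B} (p : B ⟶ B) (q : B ⟶ C)
      (q' : C ⟶ B) (r : B ⟶ D) (s : D ⟶ D') (hp : p = 𝟙 _) (hq : q ≫ q' = 𝟙 _) :
      (k ≫ p ≫ q) ≫ q' ≫ r ≫ s = k ≫ r ≫ s := by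
    simp [hp, reassoc_of% hq]
  refine Eq.trans ?_ (key _ _ _ _ _ h1 e)
  unfold pullHom
  congr 3
  · exact congr(($e₁).hom.toNatTrans)
  · exact congr(($e₂).inv.toNatTrans.app y.fiber)

variable [IsFppfStack X]

/-- All arrows of the total category are cartesian: together with `exists_lift`, a morphism is
determined by its composition with an arrow and by the underlying morphism of schemes. -/
lemma hom_ext_of_comp {a b c : CoGrothendieck X} (f : a ⟶ b) {k k' : c ⟶ a}
    (h : k.base = k'.base) (w : k ≫ f = k' ≫ f) : k = k' := by
  obtain ⟨l, kf⟩ := k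
  obtain ⟨l', kf'⟩ := k'
  obtain rfl : l = l' := h
  have := IsGroupoid.all_isIso f.fiber
  have e : (X.mapComp f.base.op.toLoc l.op.toLoc).inv.toNatTrans.app b.fiber ≫
      (X.mapComp f.base.op.toLoc l.op.toLoc).hom.toNatTrans.app b.fiber = 𝟙 _ := by
    rw [← Cat.Hom₂.comp_app, Iso.inv_hom_id]; rfl
  have key {A B C D : X.obj ⟨op c.base⟩} {k k' : A ⟶ B} (p : B ⟶ C) [IsIso p] (q : C ⟶ D)
      (q' : D ⟶ C) (hq : q ≫ q' = 𝟙 _) (h : k ≫ p ≫ q = k' ≫ p ≫ q) : k = k' := by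
    have h' := h =≫ q'
    simpa [hq, cancel_mono] using h'
  have w' := (CoGrothendieck.Hom.congr w).trans (Category.comp_id _)
  obtain rfl : kf = kf' := key _ _ _ e w'
  rfl

lemma mono_of_base {a b : CoGrothendieck X} (f : a ⟶ b) [Mono f.base] : Mono f where
  right_cancellation _ _ h := hom_ext_of_comp f
    ((cancel_mono f.base).1 congr(($h).base)) h

lemma isPullback_of_base {P W V U : CoGrothendieck X} {a : P ⟶ W} {b : P ⟶ V} {w : W ⟶ U}
    {v : V ⟶ U} (h : a ≫ w = b ≫ v) (hb : IsPullback a.base b.base w.base v.base) :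
    IsPullback a b w v := by
  have lift (s : Limits.PullbackCone w v) : ∃ k : s.pt ⟶ P, k ≫ a = s.fst ∧ k ≫ b = s.snd := by
    obtain ⟨k, hk, hk'⟩ := exists_lift a s.fst
      (hb.lift s.fst.base s.snd.base congr(($s.condition).base)) (hb.lift_fst ..)
    refine ⟨k, hk', hom_ext_of_comp v ?_ ?_⟩
    · exact congr($hk ≫ b.base).trans (hb.lift_snd ..)
    · rw [Category.assoc, ← h, reassoc_of% hk', s.condition]
  refine ⟨⟨h⟩, ⟨Limits.PullbackCone.IsLimit.mk _ (fun s ↦ (lift s).choose)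
    (fun s ↦ (lift s).choose_spec.1) (fun s ↦ (lift s).choose_spec.2) fun s m h₁ h₂ ↦ ?_⟩⟩
  refine hom_ext_of_comp a (hb.hom_ext ?_ ?_) (h₁.trans (lift s).choose_spec.1.symm)
  · exact congr(($(h₁.trans (lift s).choose_spec.1.symm)).base)
  · exact congr(($(h₂.trans (lift s).choose_spec.2.symm)).base)

/-- The projection to schemes preserves pullbacks. -/
lemma isPullback_base {P W V U : CoGrothendieck X} {a : P ⟶ W} {b : P ⟶ V} {w : W ⟶ U}
    {v : V ⟶ U} (h : IsPullback a b w v) : IsPullback a.base b.base w.base v.base := by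
  have lift (s : Limits.PullbackCone w.base v.base) :
      ∃! l : s.pt ⟶ P.base, l ≫ a.base = s.fst ∧ l ≫ b.base = s.snd := by
    obtain ⟨z, f, hf⟩ := exists_cartesianLift W s.fst
    obtain ⟨g, hg, hgv⟩ := exists_lift v (f ≫ w) s.snd
      (s.condition.symm.trans congr($hf.symm ≫ w.base))
    refine ⟨(h.lift f g hgv.symm).base, ⟨?_, ?_⟩, ?_⟩
    · exact congr(($(h.lift_fst f g hgv.symm)).base).trans hf
    · exact congr(($(h.lift_snd f g hgv.symm)).base).trans hg
    · rintro m ⟨hm₁, hm₂⟩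
      obtain ⟨k, rfl, hk⟩ := exists_lift a f m (hm₁.trans hf.symm)
      have hk' : k ≫ b = g := hom_ext_of_comp v (hm₂.trans hg.symm) (by
        rw [Category.assoc, ← h.w, reassoc_of% hk, hgv])
      exact congr(($(h.hom_ext (hk.trans (h.lift_fst f g hgv.symm).symm)
        (hk'.trans (h.lift_snd f g hgv.symm).symm))).base)
  refine ⟨⟨congr(($h.w).base)⟩, ⟨Limits.PullbackCone.IsLimit.mk _ (fun s ↦ (lift s).choose)
    (fun s ↦ (lift s).choose_spec.1.1) (fun s ↦ (lift s).choose_spec.1.2) fun s m h₁ h₂ ↦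
      (lift s).choose_spec.2 m ⟨h₁, h₂⟩⟩⟩

/-- The `2`-fibre product is the product in the total category. -/
lemma FiberProduct.isProductCone {x y : CoGrothendieck X} (Q : FiberProduct x.fiber y.fiber) :
    IsProductCone Q.toFst Q.toSnd := by
  intro z f g
  have := IsGroupoid.all_isIso f.fiber
  have := IsGroupoid.all_isIso g.fiber
  let φ := (asIso f.fiber).symm ≪≫ asIso g.fiber
  have h := Q.existsUnique_lift f.base g.base φ
  obtain ⟨l, hl₁, hl₂, hl⟩ := h.exists
  obtain ⟨k, rfl, rfl⟩ := exists_lift Q.toFst f l hl₁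
  refine ⟨k, ⟨rfl, ?_⟩, ?_⟩
  · have hk := Q.fiber_comp_pullHom (k := k) rfl rfl
    obtain ⟨gb, gf⟩ := g
    obtain rfl : (k ≫ Q.toSnd).base = gb := hl₂
    refine CoGrothendieck.Hom.ext _ _ rfl ?_
    refine (hk.symm.trans ?_).trans (Category.comp_id _).symm
    exact (congr((k ≫ Q.toFst).fiber ≫ $hl)).trans (IsIso.hom_inv_id_assoc _ _)
  · rintro k' ⟨h₁, rfl⟩
    refine hom_ext_of_comp Q.toFst ?_ h₁
    refine h.unique ⟨congr(($h₁).base), rfl, ?_⟩ ⟨hl₁, hl₂, hl⟩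
    rw [← cancel_epi (k ≫ Q.toFst).fiber]
    refine Eq.trans ?_ (IsIso.hom_inv_id_assoc (k ≫ Q.toFst).fiber (k' ≫ Q.toSnd).fiber).symm
    exact Q.fiber_comp_pullHom h₁ rfl

end TotalCategory

lemma _root_.IsProductCone.exists_iso {D : Type*} [Category* D] {P P' W V : D} {a : P ⟶ W}
    {b : P ⟶ V} {a' : P' ⟶ W} {b' : P' ⟶ V} (h : IsProductCone a b) (h' : IsProductCone a' b') :
    ∃ e : P' ≅ P, e.hom ≫ a = a' := by
  obtain ⟨f, hf₁, hf₂⟩ := (h a' b').exists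
  obtain ⟨g, hg₁, hg₂⟩ := (h' a b).exists
  exact ⟨⟨f, g, h'.hom_ext (by simp [hf₁, hg₁]) (by simp [hf₂, hg₂]),
    h.hom_ext (by simp [hf₁, hg₁]) (by simp [hf₂, hg₂])⟩, hf₁⟩

/-! ### The fppf site of a stack -/

section Site

variable {X : FiberedCat.{u}} [IsFppfStack X]

/-- The projection along a finite locally free cover of degree `d` of any product in the total
category is finite locally free of degree `d`. -/
lemma IsFiniteLocallyFreeCover.of_isProductCone {y : CoGrothendieck X} {d : ℕ}
    (hy : IsFiniteLocallyFreeCover y.fiber d) {P x : CoGrothendieck X} {a : P ⟶ x} {b : P ⟶ y}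
    (h : IsProductCone a b) :
    Surjective a.base ∧ IsFinite a.base ∧ Flat a.base ∧ LocallyOfFinitePresentation a.base ∧
      ∀ s, a.base.finrank s = d := by
  have key {A B C : Scheme.{u}} (f : A ⟶ B) (g : B ⟶ C) [IsIso f] (h₁ : Surjective g)
      (h₂ : IsFinite g) (h₃ : Flat g) (h₄ : LocallyOfFinitePresentation g)
      (h₅ : ∀ s, g.finrank s = d) : Surjective (f ≫ g) ∧ IsFinite (f ≫ g) ∧ Flat (f ≫ g) ∧
        LocallyOfFinitePresentation (f ≫ g) ∧ ∀ s, (f ≫ g).finrank s = d :=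
    ⟨inferInstance, inferInstance, inferInstance, inferInstance,
      by rwa [Scheme.Hom.finrank_comp_left_of_isIso]⟩
  obtain ⟨Q, h₁, h₂, h₃, h₄, h₅⟩ := hy x.fiber
  obtain ⟨e, rfl⟩ := Q.isProductCone.exists_iso h
  have : IsIso e.hom.base := inferInstanceAs (IsIso ((CoGrothendieck.forget X).map e.hom))
  exact key e.hom.base Q.fst h₁ h₂ h₃ h₄ h₅

lemma IsFiniteLocallyFreeCover.exists_powerSystem {y : CoGrothendieck X} {d : ℕ}
    (hy : IsFiniteLocallyFreeCover y.fiber d) [IsAffine y.base] :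
    ∃ P : PowerSystem y, ∀ k, IsAffine (P.pow k).base := by
  refine _root_.exists_powerSystem (aff := fun x : CoGrothendieck X ↦ IsAffine x.base)
    inferInstance fun W hW ↦ ?_
  obtain ⟨Q, _, h, -⟩ := hy W.fiber
  have : IsFinite Q.toFst.base := h
  exact ⟨Q.obj, Q.toFst, Q.toSnd, isAffine_of_isAffineHom Q.toFst.base, Q.isProductCone⟩

/-- A flat surjective morphism of affine schemes, locally of finite presentation. -/
structure IsAffineCovering {V U : CoGrothendieck X} (p : V ⟶ U) : Prop where
  isAffine_left : IsAffine V.base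
  isAffine_right : IsAffine U.base
  flat : Flat p.base
  surjective : Surjective p.base
  locallyOfFinitePresentation : LocallyOfFinitePresentation p.base

lemma IsAffineCovering.exists_powerSystem {V U : CoGrothendieck X} {p : V ⟶ U}
    (hp : IsAffineCovering p) :
    ∃ P : PowerSystem (Over.mk p), ∀ k, IsAffine (P.pow k).left.base := by
  have := hp.isAffine_left
  have := hp.isAffine_right
  refine _root_.exists_powerSystem (aff := fun x : Over U ↦ IsAffine x.left.base) hp.isAffine_left
    fun W hW ↦ ?_
  obtain ⟨z, f, hf⟩ := exists_cartesianLift W.left (Limits.pullback.fst W.hom.base p.base)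
  obtain ⟨g, hg, w⟩ := exists_lift p (f ≫ W.hom) (Limits.pullback.snd W.hom.base p.base)
    (Limits.pullback.condition.symm.trans congr($hf.symm ≫ W.hom.base))
  have h : IsPullback f g W.hom p := isPullback_of_base w.symm (by
    rw [hf, hg]; exact .of_hasPullback _ _)
  refine ⟨_, _, _, ?_, h.isProductCone⟩
  exact inferInstanceAs (IsAffine (Limits.pullback W.hom.base p.base))

/-- A family of arrows is covering if the underlying morphisms of schemes are. -/
lemma ofArrows_mem_fppfSite {U : CoGrothendieck X} {ι : Type*} {Z : ι → CoGrothendieck X}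
    (f : ∀ i, Z i ⟶ U)
    (h : Sieve.ofArrows (fun i ↦ (Z i).base) (fun i ↦ (f i).base) ∈
      Scheme.fppfTopology.{u} U.base) :
    Sieve.ofArrows Z f ∈ fppfSite X U := by
  refine Scheme.fppfTopology.superset_covering ?_ h
  rintro T _ ⟨_, a, _, ⟨i⟩, rfl⟩
  exact ⟨Z i, f i, a, Sieve.ofArrows_mk _ _ i, rfl⟩

lemma bot_mem_fppfSite (U : CoGrothendieck X) [IsEmpty U.base] : ⊥ ∈ fppfSite X U :=
  Scheme.fppfTopology.superset_covering (Sieve.generate_le_iff _ _ |>.2 bot_le)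
    (Precoverage.generate_mem_toGrothendieck (Scheme.bot_mem_precoverage _ U.base))

lemma IsAffineCovering.generate_mem {V U : CoGrothendieck X} {p : V ⟶ U}
    (hp : IsAffineCovering p) : Sieve.generate (Presieve.singleton p) ∈ fppfSite X U := by
  have := hp.flat
  have := hp.surjective
  have := hp.locallyOfFinitePresentation
  refine Scheme.fppfTopology.superset_covering ?_
    (Precoverage.generate_mem_toGrothendieck p.base.singleton_mem_fppfPrecoverage)
  rintro T _ ⟨_, a, _, ⟨⟩, rfl⟩
  exact ⟨V, p, a, Sieve.le_generate _ _ _ ⟨⟩, rfl⟩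

/-- Every object has a covering by objects mapping to a finite locally free cover. -/
lemma IsFiniteLocallyFreeCover.exists_covering {y : CoGrothendieck X} {d : ℕ}
    (hy : IsFiniteLocallyFreeCover y.fiber d) (W : CoGrothendieck X) :
    ∃ R ∈ fppfSite X W, ∀ (Z : CoGrothendieck X) (f : Z ⟶ W), R f → Nonempty (Z ⟶ y) := by
  obtain ⟨Q, _, _, _, _, -⟩ := hy W.fiber
  refine ⟨Sieve.generate (Presieve.singleton Q.toFst), ?_, ?_⟩
  · refine Scheme.fppfTopology.superset_covering ?_
      (Precoverage.generate_mem_toGrothendieck Q.fst.singleton_mem_fppfPrecoverage)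
    rintro T _ ⟨_, a, _, ⟨⟩, rfl⟩
    exact ⟨Q.obj, Q.toFst, a, Sieve.le_generate _ _ _ ⟨⟩, rfl⟩
  · rintro Z _ ⟨_, a, _, ⟨⟩, rfl⟩
    exact ⟨a ≫ Q.toSnd⟩

open Limits in
/-- Every covering of an affine object is refined by a finite disjoint union of affine schemes
which is faithfully flat and locally of finite presentation. -/
lemma exists_isAffineCovering {U : CoGrothendieck X} [IsAffine U.base] {R : Sieve U}
    (hR : R ∈ fppfSite X U) :
    ∃ (V : CoGrothendieck X) (p : V ⟶ U), IsAffineCovering p ∧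
      ∃ (ι : Type u) (Z : ι → CoGrothendieck X) (s : ∀ i, Z i ⟶ V),
        Sieve.ofArrows Z s ∈ fppfSite X V ∧ (∀ i, Mono (s i)) ∧ (∀ i, R (s i ≫ p)) ∧
          ∀ ⦃i j : ι⦄ ⦃T : CoGrothendieck X⦄ (a : T ⟶ Z i) (b : T ⟶ Z j), i ≠ j →
            a ≫ s i = b ≫ s j → ⊥ ∈ fppfSite X T := by
  obtain ⟨ι, _, Z, f, _, hf, _, _, _⟩ := exists_affine_refinement_fppf hR
  obtain ⟨v, p, hp⟩ := exists_cartesianLift U (Sigma.desc f)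
  let V : CoGrothendieck X := ⟨∐ Z, v⟩
  have lift (i) : ∃ (z : X.obj ⟨op (Z i)⟩) (s : (⟨Z i, z⟩ : CoGrothendieck X) ⟶ V),
      s.base = Sigma.ι Z i := exists_cartesianLift V _
  choose z s hs using lift
  refine ⟨V, p, ⟨inferInstanceAs (IsAffine (∐ Z)), ‹_›, hp ▸ ‹_›, hp ▸ ‹_›, hp ▸ ‹_›⟩, ι,
    fun i ↦ ⟨Z i, z i⟩, s, ?_, fun i ↦ ?_, fun i ↦ ?_, ?_⟩
  · refine ofArrows_mem_fppfSite _ ?_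
    simp only [hs]
    refine Precoverage.generate_mem_toGrothendieck
      (Scheme.zariskiPrecoverage_le_fppfPrecoverage _ (sigmaOpenCover Z).mem₀)
  · have : Mono (s i).base := by rw [hs]; infer_instance
    exact mono_of_base _
  · obtain ⟨W, r, h, hr, w⟩ := hf i
    obtain ⟨k, -, hk⟩ := exists_lift r (s i ≫ p) h (by
      refine w.symm.trans ((Sigma.ι_desc _ _).symm.trans ?_)
      exact congr($((hs i).symm) ≫ $(hp.symm)))
    exact hk ▸ R.downward_closed hr k
  · intro i j T a b hij h
    have : IsEmpty T.base := isEmpty_of_commSq_sigmaι_of_ne (g := Z) (a := a.base)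
      (b := b.base) ⟨by rw [← hs, ← hs]; exact congr(($h).base)⟩ hij
    exact bot_mem_fppfSite T

variable (X) in
/-- The affine faithfully flat coverings on the fppf site of a stack. -/
noncomputable def affineBasis : CoveringBasis (fppfSite X) where
  aff x := IsAffine x.base
  Cov _ _ p := IsAffineCovering p
  powers _ _ _ hp := hp.exists_powerSystem.choose
  aff_powers _ _ _ hp := hp.exists_powerSystem.choose_spec
  mem _ _ _ hp := hp.generate_mem
  refine _ _ _ hR := exists_isAffineCovering hR

end Site

end WellNighAffine

/-! ### Base change along ring homomorphisms -/

section BaseChange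

variable {A B A' B' : CommRingCat.{u}} {M N M' N' : Type u} [AddCommGroup M] [AddCommGroup N]
  [AddCommGroup M'] [AddCommGroup N'] [Module A M] [Module B N] [Module A' M'] [Module B' N']

/-- The additive map `r : M → N` is semilinear along the ring homomorphism `φ : A → B` and
identifies the `B`-module `N` with the base change of the `A`-module `M`. -/
structure IsBaseChangeAlong (φ : A ⟶ B) (r : M →+ N) : Prop where
  map_smul (a : A) (m : M) : r (a • m) = φ.hom a • r m
  isBaseChange :
    letI := φ.hom.toAlgebra
    letI := Module.compHom N φ.hom
    haveI : IsScalarTower A B N := .of_algebraMap_smul fun _ _ ↦ rfl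
    IsBaseChange B ({ r with map_smul' := map_smul } : M →ₗ[A] N)

/-- The ring homomorphism `φ : A → B` makes `B` a finite projective module of constant rank `d`
over `A`. -/
structure IsFiniteProjectiveOfRank (φ : A ⟶ B) (d : ℕ) : Prop where
  finite : letI := φ.hom.toAlgebra; Module.Finite A B
  projective : letI := φ.hom.toAlgebra; Module.Projective A B
  rankAtStalk_eq : letI := φ.hom.toAlgebra; ∀ p, Module.rankAtStalk (R := A) B p = d

namespace IsBaseChangeAlong

/-- The transfer map `N → M`, `b ⊗ m ↦ Tr(b) m`, for a base change along a finite projective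
ring homomorphism. -/
noncomputable def transfer {φ : A ⟶ B} {r : M →+ N} (h : IsBaseChangeAlong φ r) {d : ℕ}
    (hφ : IsFiniteProjectiveOfRank φ d) : N →+ M :=
  letI := φ.hom.toAlgebra
  letI := Module.compHom N φ.hom
  haveI : IsScalarTower A B N := .of_algebraMap_smul fun _ _ ↦ rfl
  haveI := hφ.finite
  haveI := hφ.projective
  h.isBaseChange.transfer.toAddMonoidHom

lemma transfer_apply {φ : A ⟶ B} {r : M →+ N} (h : IsBaseChangeAlong φ r) {d : ℕ}
    (hφ : IsFiniteProjectiveOfRank φ d) (m : M) : h.transfer hφ (r m) = d • m :=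
  let := φ.hom.toAlgebra
  let := Module.compHom N φ.hom
  have : IsScalarTower A B N := .of_algebraMap_smul fun _ _ ↦ rfl
  have := hφ.finite
  have := hφ.projective
  h.isBaseChange.transfer_apply hφ.rankAtStalk_eq m

lemma transfer_naturality {φ : A ⟶ B} {r : M →+ N} (h : IsBaseChangeAlong φ r) {d : ℕ}
    (hφ : IsFiniteProjectiveOfRank φ d) {φ' : A' ⟶ B'} {r' : M' →+ N'}
    (h' : IsBaseChangeAlong φ' r') (hφ' : IsFiniteProjectiveOfRank φ' d) {α : A ⟶ A'} {β : B ⟶ B'}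
    (hp : IsPushout α φ φ' β) {f : M →+ M'} (hf : ∀ (a : A) m, f (a • m) = α.hom a • f m)
    {g : N →+ N'} (hg : ∀ (b : B) n, g (b • n) = β.hom b • g n)
    (w : ∀ m, g (r m) = r' (f m)) (n : N) :
    h'.transfer hφ' (g n) = f (h.transfer hφ n) := by
  let := φ.hom.toAlgebra
  let := Module.compHom N φ.hom
  have : IsScalarTower A B N := .of_algebraMap_smul fun _ _ ↦ rfl
  have := hφ.finite
  have := hφ.projective
  let := φ'.hom.toAlgebra
  let := Module.compHom N' φ'.hom
  have : IsScalarTower A' B' N' := .of_algebraMap_smul fun _ _ ↦ rfl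
  have := hφ'.finite
  have := hφ'.projective
  let := α.hom.toAlgebra
  let := β.hom.toAlgebra
  let := (α ≫ φ').hom.toAlgebra
  have : IsScalarTower A A' B' := .of_algebraMap_eq fun _ ↦ rfl
  have : IsScalarTower A B B' := .of_algebraMap_eq fun a ↦ congr(($(hp.w)).hom a)
  have : Algebra.IsPushout A A' B B' := CommRingCat.isPushout_iff_isPushout.1 hp
  exact h.isBaseChange.transfer_naturality h'.isBaseChange f hf g hg w n

/-- A base change along the cobase change `φ'` of `φ` is generated by the image as a module over
the target of `φ`. -/
lemma induction_of_isPushout {φ : A ⟶ B} {φ' : A' ⟶ B'} {α : A ⟶ A'} {β : B ⟶ B'}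
    (hp : IsPushout α φ φ' β) {r : M' →+ N'} (h : IsBaseChangeAlong φ' r)
    {p : N' → Prop} (zero : p 0) (add : ∀ x y, p x → p y → p (x + y))
    (smul : ∀ (b : B) m, p (β.hom b • r m)) (n : N') : p n := by
  let := φ.hom.toAlgebra
  let := φ'.hom.toAlgebra
  let := Module.compHom N' φ'.hom
  have : IsScalarTower A' B' N' := .of_algebraMap_smul fun _ _ ↦ rfl
  let := α.hom.toAlgebra
  let := β.hom.toAlgebra
  let := (α ≫ φ').hom.toAlgebra
  have : IsScalarTower A A' B' := .of_algebraMap_eq fun _ ↦ rfl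
  have : IsScalarTower A B B' := .of_algebraMap_eq fun a ↦ congr(($(hp.w)).hom a)
  have : Algebra.IsPushout A A' B B' := CommRingCat.isPushout_iff_isPushout.1 hp
  let := Module.compHom M' α.hom
  let := Module.compHom N' (α ≫ φ').hom
  let := Module.compHom N' β.hom
  have : IsScalarTower A A' M' := .of_algebraMap_smul fun _ _ ↦ rfl
  have : IsScalarTower B B' N' := .of_algebraMap_smul fun _ _ ↦ rfl
  have : IsScalarTower A A' N' := .of_algebraMap_smul fun _ _ ↦ rfl
  have : IsScalarTower A B N' := .of_algebraMap_smul fun a n ↦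
    congr(($(hp.w)).hom a • n).symm
  have H := IsBaseChange.of_isPushout A B h.isBaseChange
  obtain ⟨x, rfl⟩ := H.equiv.surjective n
  induction x using TensorProduct.induction_on with
  | zero => simpa using zero
  | tmul b m =>
    rw [H.equiv_tmul]
    exact smul b m
  | add x y hx hy =>
    rw [map_add]
    exact add _ _ hx hy

/-- If `φ` is faithfully flat, membership in a submodule can be tested after a base change along
the cobase change `φ'` of `φ`. -/
lemma mem_of_isPushout {φ : A ⟶ B} (hφ : φ.hom.FaithfullyFlat) {φ' : A' ⟶ B'} {α : A ⟶ A'}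
    {β : B ⟶ B'} (hp : IsPushout α φ φ' β) {r : M' →+ N'} (h : IsBaseChangeAlong φ' r)
    (S : AddSubgroup M') (hS : ∀ (a : A), ∀ s ∈ S, α.hom a • s ∈ S) (m : M')
    (hm : ∀ T : AddSubgroup N', (∀ (b : B), ∀ s ∈ S, β.hom b • r s ∈ T) → r m ∈ T) : m ∈ S := by
  let := φ.hom.toAlgebra
  let := φ'.hom.toAlgebra
  let := Module.compHom N' φ'.hom
  have : IsScalarTower A' B' N' := .of_algebraMap_smul fun _ _ ↦ rfl
  let := α.hom.toAlgebra
  let := β.hom.toAlgebra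
  let := (α ≫ φ').hom.toAlgebra
  have : IsScalarTower A A' B' := .of_algebraMap_eq fun _ ↦ rfl
  have : IsScalarTower A B B' := .of_algebraMap_eq fun a ↦ congr(($(hp.w)).hom a)
  have : Algebra.IsPushout A A' B B' := CommRingCat.isPushout_iff_isPushout.1 hp
  let := Module.compHom M' α.hom
  let := Module.compHom N' (α ≫ φ').hom
  let := Module.compHom N' β.hom
  have : IsScalarTower A A' M' := .of_algebraMap_smul fun _ _ ↦ rfl
  have : IsScalarTower B B' N' := .of_algebraMap_smul fun _ _ ↦ rfl
  have : IsScalarTower A A' N' := .of_algebraMap_smul fun _ _ ↦ rfl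
  have : IsScalarTower A B N' := .of_algebraMap_smul fun a n ↦
    congr(($(hp.w)).hom a • n).symm
  have H := IsBaseChange.of_isPushout A B h.isBaseChange
  have : Module.FaithfullyFlat A B := hφ
  refine H.mem_of_mem_span { S with smul_mem' := fun a s hs ↦ hS a s hs } m ?_
  exact hm (Submodule.span B _).toAddSubgroup fun b s hs ↦
    Submodule.smul_mem _ b (Submodule.subset_span ⟨s, hs, rfl⟩)

end IsBaseChangeAlong

end BaseChange

lemma isFiniteProjectiveOfRank_appTop {Z S : Scheme.{u}} [IsAffine S] [IsAffine Z] (f : Z ⟶ S)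
    [IsFinite f] [Flat f] [LocallyOfFinitePresentation f] {d : ℕ} (hd : ∀ s, f.finrank s = d) :
    IsFiniteProjectiveOfRank f.appTop d := by
  have h₁ : f.appTop.hom.Finite := f.finite_appTop
  have h₂ : f.appTop.hom.Flat := f.flat_appTop
  have h₃ : f.appTop.hom.FinitePresentation :=
    HasRingHomProperty.appTop (P := @LocallyOfFinitePresentation) _ inferInstance
  let := f.appTop.hom.toAlgebra
  have : Module.Finite Γ(S, ⊤) Γ(Z, ⊤) := h₁
  have : Module.Flat Γ(S, ⊤) Γ(Z, ⊤) := h₂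
  have : Algebra.FinitePresentation Γ(S, ⊤) Γ(Z, ⊤) := h₃
  have := Module.FinitePresentation.of_finite_of_finitePresentation Γ(S, ⊤) Γ(Z, ⊤)
  refine ⟨h₁, Module.Flat.projective_of_finitePresentation, fun p ↦ ?_⟩
  have e : IsPullback Z.isoSpec.inv (Spec.map f.appTop) f S.isoSpec.inv :=
    IsPullback.of_horiz_isIso ⟨(Scheme.isoSpec_inv_naturality f).symm⟩
  have := Scheme.Hom.finrank_of_isPullback _ _ _ _ e p
  rw [hd] at this
  rw [← this]
  exact (Scheme.Hom.finrank_SpecMap_algebraMap Γ(S, ⊤) Γ(Z, ⊤) p).symm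

namespace WellNighAffine

/-! ### Čech cohomology of quasi-coherent modules -/

section Sections

variable {X : FiberedCat.{u}} [IsFppfStack X] (F : SheafOfModules.{u} (structureSheaf X))

/-- The restriction map of sections, as an additive map. -/
noncomputable def res {y x : CoGrothendieck X} (f : y ⟶ x) : sections F x →+ sections F y :=
  (restrict F f).hom.toAddMonoidHom

lemma res_smul {y x : CoGrothendieck X} (f : y ⟶ x) (a : Γ(x.base, ⊤)) (m : sections F x) :
    res F f (a • m) = f.base.appTop.hom a • res F f m :=
  (restrict F f).hom.map_smul a m

/-- The underlying presheaf of abelian groups of `F`. -/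
noncomputable abbrev addPresheaf : (CoGrothendieck X)ᵒᵖ ⥤ AddCommGrpCat.{u} :=
  ((SheafOfModules.toSheaf (structureSheaf X)).obj F).obj

lemma res_comp {z y x : CoGrothendieck X} (g : z ⟶ y) (f : y ⟶ x) (m : sections F x) :
    res F (g ≫ f) m = res F g (res F f m) :=
  congr($((addPresheaf F).map_comp f.op g.op) m)

variable {F}

lemma IsQuasiCoherent.isBaseChangeAlong (hF : IsQuasiCoherent F) {y x : CoGrothendieck X}
    (f : y ⟶ x) [IsAffine y.base] [IsAffine x.base] :
    IsBaseChangeAlong f.base.appTop (res F f) := by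
  refine ⟨res_smul F f, ?_⟩
  have := hF f
  let e := (asIso (((ModuleCat.extendRestrictScalarsAdj f.base.appTop.hom).homEquiv _ _).symm
      (restrict F f))).toLinearEquiv
  let := f.base.appTop.hom.toAlgebra
  let := Module.compHom (sections F y) f.base.appTop.hom
  have : IsScalarTower Γ(x.base, ⊤) Γ(y.base, ⊤) (sections F y) := .of_algebraMap_smul fun _ _ ↦ rfl
  refine IsBaseChange.of_equiv e fun m ↦ ?_
  have h := ModuleCat.extendRestrictScalarsAdj_homEquiv_apply
    (((ModuleCat.extendRestrictScalarsAdj f.base.appTop.hom).homEquiv _ _).symm (restrict F f)) m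
  rw [Equiv.apply_symm_apply] at h
  exact h.symm

end Sections

open TensorProduct in
/-- The structure sheaf is quasi-coherent. -/
lemma isQuasiCoherent_unit (X : FiberedCat.{u}) [IsFppfStack X] :
    IsQuasiCoherent (SheafOfModules.unit (structureSheaf X)) := by
  intro y x f _ _
  set F := SheafOfModules.unit (structureSheaf X)
  set g := ((ModuleCat.extendRestrictScalarsAdj f.base.appTop.hom).homEquiv _ _).symm
    (restrict F f) with hg
  let := f.base.appTop.hom.toAlgebra
  have H := IsBaseChange.linearMap Γ(x.base, ⊤) Γ(y.base, ⊤)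
  have h (a : Γ(x.base, ⊤)) :
      g.hom ((1 : Γ(y.base, ⊤)) ⊗ₜ[Γ(x.base, ⊤)] a) = f.base.appTop.hom a := by
    have h := ModuleCat.extendRestrictScalarsAdj_homEquiv_apply g a
    rw [hg, Equiv.apply_symm_apply] at h
    exact h.symm
  have key (t : TensorProduct Γ(x.base, ⊤) Γ(y.base, ⊤) Γ(x.base, ⊤)) : g.hom t = H.equiv t := by
    induction t using TensorProduct.induction_on with
    | zero => exact g.hom.map_zero.trans H.equiv.map_zero.symm
    | tmul b a =>
      refine Eq.trans ?_ (H.equiv_tmul b a).symm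
      refine Eq.trans ?_ congr(b • $(h a))
      refine Eq.trans ?_ (g.hom.map_smul b _)
      have e : b ⊗ₜ[Γ(x.base, ⊤)] a = b • ((1 : Γ(y.base, ⊤)) ⊗ₜ[Γ(x.base, ⊤)] a) := by
        rw [TensorProduct.smul_tmul', smul_eq_mul, mul_one]
      exact congrArg g.hom e
    | add s t hs ht =>
      exact (g.hom.map_add s t).trans (congr($hs + $ht).trans (H.equiv.map_add s t).symm)
  rw [ConcreteCategory.isIso_iff_bijective]
  have : ⇑g.hom = H.equiv := funext key
  exact this ▸ H.equiv.bijective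

section CechSections

variable {X : FiberedCat.{u}} [IsFppfStack X] {F : SheafOfModules.{u} (structureSheaf X)}

/-- All but the last term of an alternating sum with value zero. -/
lemma sum_castSucc_eq {M : Type*} [AddCommGroup M] {k : ℕ} (f : Fin (k + 3) → M)
    (h : ∑ i : Fin (k + 3), (-1 : ℤ) ^ (i : ℕ) • f i = 0) :
    ∑ i : Fin (k + 2), (-1 : ℤ) ^ (i : ℕ) • f i.castSucc = (-1 : ℤ) ^ (k + 1) • f (Fin.last _) := by
  rw [Fin.sum_univ_castSucc] at h
  refine (eq_neg_of_add_eq_zero_left h).trans ?_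
  rw [Fin.val_last, pow_succ _ (k + 1)]
  simp

/-- Čech cocycles of a quasi-coherent module on a faithfully flat affine covering are coboundaries.
By faithfully flat descent this may be checked after base change to the covering, where
the last component provides a contraction of the Čech complex. -/
lemma IsQuasiCoherent.cechKilled_over (hF : IsQuasiCoherent F) {V U : CoGrothendieck X}
    {p : V ⟶ U} (hp : IsAffineCovering p) (P : PowerSystem (Over.mk p))
    (hP : ∀ k, IsAffine (P.pow k).left.base) :
    P.CechKilled ((Over.forget U).op ⋙ addPresheaf F) 1 := by
  have := hp.isAffine_left
  have := hp.isAffine_right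
  have hpush (k : ℕ) : IsPushout (P.pow k).hom.base.appTop p.base.appTop
      (P.face (Fin.last (k + 1))).left.base.appTop (P.pr (Fin.last (k + 1))).left.base.appTop :=
    isPushout_appTop_of_isPullback (isPullback_base (P.isProductCone k).isPullback)
  have hff : p.base.appTop.hom.FaithfullyFlat :=
    (Flat.flat_and_surjective_iff_faithfullyFlat_of_isAffine _).1 ⟨hp.flat, hp.surjective⟩
  let D (k : ℕ) : sections F (P.pow k).left →+ sections F (P.pow (k + 1)).left :=
    ∑ i : Fin (k + 2), (-1 : ℤ) ^ (i : ℕ) • res F (P.face i).left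
  have hD (k : ℕ) (c : sections F (P.pow k).left) :
      D k c = ∑ i : Fin (k + 2), (-1 : ℤ) ^ (i : ℕ) • res F (P.face i).left c := by
    simp [D]
  have hface {k : ℕ} (i : Fin (k + 2)) (a : Γ(U.base, ⊤)) :
      (P.face i).left.base.appTop.hom ((P.pow k).hom.base.appTop.hom a) =
        (P.pow (k + 1)).hom.base.appTop.hom a := by
    rw [← Over.w (P.face i)]
    exact congr($((Scheme.Hom.comp_appTop (P.face i).left.base (P.pow k).hom.base)).hom a).symm
  have hpr {k : ℕ} (i : Fin (k + 2)) (b : Γ(V.base, ⊤)) :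
      (P.face i.castSucc).left.base.appTop.hom ((P.pr (Fin.last (k + 1))).left.base.appTop.hom b) =
        (P.pr (Fin.last (k + 2))).left.base.appTop.hom b := by
    rw [← P.face_castSucc_comp_pr_last i]
    exact congr($((Scheme.Hom.comp_appTop (P.face i.castSucc).left.base
      (P.pr (Fin.last (k + 1))).left.base)).hom b).symm
  have key (k : ℕ) (c : sections F (P.pow (k + 1)).left) (hc : D (k + 1) c = 0) :
      c ∈ (D k).range := by
    refine (hF.isBaseChangeAlong (P.face (Fin.last (k + 2))).left).mem_of_isPushout hff
      (hpush (k + 1)) (D k).range ?_ c fun T hT ↦ ?_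
    -- the coboundaries are stable under functions on `U`
    · rintro a _ ⟨b, rfl⟩
      refine ⟨(P.pow k).hom.base.appTop.hom a • b, ?_⟩
      simp only [hD, res_smul, hface, Finset.smul_sum]
      refine Finset.sum_congr rfl fun i _ ↦ ?_
      rw [smul_comm]
    -- as `c` is a cocycle, its pullback along the last face map is, up to a sign, the alternating
    -- sum of its pullbacks along the other ones
    · have h : ∑ i : Fin (k + 2), (-1 : ℤ) ^ (i : ℕ) • res F (P.face i.castSucc).left c ∈ T := by
        clear hc
        -- for a multiple of the pullback of `m` along the last face map, this sum is the same
        -- multiple of the pullback of `D m`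
        refine (hF.isBaseChangeAlong (P.face (Fin.last (k + 1))).left).induction_of_isPushout
          (p := fun c ↦ ∑ i : Fin (k + 2),
            (-1 : ℤ) ^ (i : ℕ) • res F (P.face i.castSucc).left c ∈ T)
          (hpush k) (by simp) (fun x y hx hy ↦ ?_) (fun b m ↦ ?_) c
        · simpa [Finset.sum_add_distrib] using add_mem hx hy
        · convert hT b (D k m) ⟨m, rfl⟩ using 1
          rw [hD, map_sum, Finset.smul_sum]
          refine Finset.sum_congr rfl fun i _ ↦ ?_
          rw [res_smul, hpr, map_zsmul, smul_comm, ← res_comp, ← res_comp, ← Over.comp_left,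
            ← Over.comp_left, P.face_castSucc_comp_face_last]
      rw [sum_castSucc_eq (fun i ↦ res F (P.face i).left c) ((hD _ c).symm.trans hc)] at h
      have h' := zsmul_mem h ((-1 : ℤ) ^ (k + 1))
      rwa [smul_smul, ← mul_pow, neg_one_mul, neg_neg, one_pow, one_smul] at h'
  intro k c hc
  obtain ⟨b, hb⟩ := key k c ((hD _ c).trans ((P.δ_apply _ c).symm.trans hc))
  exact ⟨b, (P.δ_apply ((Over.forget U).op ⋙ addPresheaf F) b).trans
    ((hD _ b).symm.trans (hb.trans (one_smul ℕ c).symm))⟩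

/-- The transfer along the last projection of the powers of a finite locally free cover contracts
the Čech complex of a quasi-coherent module up to multiplication by the degree. -/
lemma IsQuasiCoherent.cechKilled (hF : IsQuasiCoherent F) {y : CoGrothendieck X} {d : ℕ}
    (hy : IsFiniteLocallyFreeCover y.fiber d) (P : PowerSystem y)
    (hP : ∀ k, IsAffine (P.pow k).base) : P.CechKilled (addPresheaf F) d := by
  have hproj (k : ℕ) : IsFiniteProjectiveOfRank (P.face (Fin.last (k + 1))).base.appTop d := by
    obtain ⟨_, _, _, _, h⟩ := hy.of_isProductCone (P.isProductCone k)
    exact isFiniteProjectiveOfRank_appTop _ h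
  let t (k : ℕ) : sections F (P.pow (k + 1)) →+ sections F (P.pow k) :=
    (hF.isBaseChangeAlong (P.face (Fin.last (k + 1)))).transfer (hproj k)
  have ht {k : ℕ} (i : Fin (k + 2)) (c : sections F (P.pow (k + 1))) :
      res F (P.face i) (t k c) = t (k + 1) (res F (P.face i.castSucc) c) := by
    refine ((hF.isBaseChangeAlong (P.face (Fin.last (k + 1)))).transfer_naturality (hproj k)
      (hF.isBaseChangeAlong (P.face (Fin.last (k + 2)))) (hproj (k + 1))
      (isPushout_appTop_of_isPullback (isPullback_base (P.isPullback_face k i))).flip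
      (res_smul F _) (res_smul F _) (fun m ↦ ?_) c).symm
    rw [← res_comp, ← res_comp, P.face_castSucc_comp_face_last]
  -- the differential of `t c` is `t` of the alternating sum without the last term, which for a
  -- cocycle is `(-1) ^ (k + 1)` times the pullback along the last face map
  have key (k : ℕ) (c : sections F (P.pow (k + 1)))
      (hc : ∑ i : Fin (k + 3), (-1 : ℤ) ^ (i : ℕ) • res F (P.face i) c = 0) :
      ∑ i : Fin (k + 2), (-1 : ℤ) ^ (i : ℕ) • res F (P.face i) ((-1 : ℤ) ^ (k + 1) • t k c) =
        d • c := by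
    have h (i : Fin (k + 2)) :
        (-1 : ℤ) ^ (i : ℕ) • res F (P.face i) ((-1 : ℤ) ^ (k + 1) • t k c) =
          t (k + 1) ((-1 : ℤ) ^ (k + 1) • (-1 : ℤ) ^ (i : ℕ) • res F (P.face i.castSucc) c) := by
      rw [map_zsmul, ht, map_zsmul, map_zsmul, smul_comm]
    rw [Finset.sum_congr rfl fun i _ ↦ h i, ← map_sum, ← Finset.smul_sum]
    rw [sum_castSucc_eq (fun i ↦ res F (P.face i) c) hc, smul_smul, ← mul_pow, neg_one_mul,
      neg_neg, one_pow, one_smul]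
    exact (hF.isBaseChangeAlong _).transfer_apply (hproj (k + 1)) c
  intro k c hc
  exact ⟨_, (P.δ_apply _ _).trans (key k c ((P.δ_apply _ c).symm.trans hc))⟩

end CechSections

end WellNighAffine

/-! ### Cohomology of quasi-coherent modules -/

section ULift

universe w w' v' u'

lemma PowerSystem.CechKilled.ulift {D : Type u'} [Category.{v'} D] {V : D} {P : PowerSystem V}
    {I : Dᵒᵖ ⥤ AddCommGrpCat.{w}} {d : ℕ} (h : P.CechKilled I d) :
    P.CechKilled (I ⋙ AddCommGrpCat.uliftFunctor.{w', w}) d := by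
  have hδ (k : ℕ) (c : I.obj (op (P.pow k))) :
      P.δ (I ⋙ AddCommGrpCat.uliftFunctor.{w', w}) k ⟨c⟩ = ⟨P.δ I k c⟩ := by
    rw [δ_apply P I]
    refine (δ_apply P (I ⋙ AddCommGrpCat.uliftFunctor.{w', w}) _).trans ?_
    refine Eq.trans ?_ (map_sum AddEquiv.ulift.symm _ _).symm
    exact Finset.sum_congr rfl fun i _ ↦ (map_zsmul AddEquiv.ulift.symm _ _).symm
  intro k ⟨c⟩ hc
  obtain ⟨b, hb⟩ := h k c (congr(ULift.down $((hδ _ c).symm.trans hc)))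
  exact ⟨⟨b⟩, (hδ _ b).trans congr(ULift.up $hb)⟩

end ULift

/-- The cohomology of a quasi-coherent module is killed by the degree of a finite locally free cover
by an affine scheme. -/
theorem WellNighAffine.IsQuasiCoherent.nsmul_cohomology_eq_zero {X : FiberedCat.{u}}
    [IsFppfStack X] {F : SheafOfModules.{u} (structureSheaf X)} (hF : IsQuasiCoherent F)
    {y : CoGrothendieck X} [IsAffine y.base] {d : ℕ} (hy : IsFiniteLocallyFreeCover y.fiber d)
    (n : ℕ) (ξ : Cohomology F (n + 1)) : d • ξ = 0 := by
  obtain ⟨P, hP⟩ := hy.exists_powerSystem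
  refine _root_.nsmul_cohomology_eq_zero (B := affineBasis X) P hP ‹_› hy.exists_covering n _ ?_
    (hF.cechKilled hy P hP).ulift ξ
  intro V U p hp
  exact (hF.cechKilled_over hp _ ((affineBasis X).aff_powers p hp)).ulift

theorem mainTheorem10 (X : WellNighAffine.FiberedCat.{u}) [WellNighAffine.IsFppfStack X]
    (Y : Scheme.{u}) [IsAffine Y] (π : X.obj ⟨op Y⟩) (d : ℕ)
    (hπ : WellNighAffine.IsFiniteLocallyFreeCover π d) :
    (∀ (n : ℕ), 1 ≤ n →
      ∀ ξ : WellNighAffine.Cohomology (SheafOfModules.unit (WellNighAffine.structureSheaf X)) n,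
        d • ξ = 0) ∧
    (∀ F : SheafOfModules.{u} (WellNighAffine.structureSheaf X),
      WellNighAffine.IsQuasiCoherent F →
        ∀ (n : ℕ), 1 ≤ n → ∀ ξ : WellNighAffine.Cohomology F n, d • ξ = 0) := by
  have main (F : SheafOfModules.{u} (WellNighAffine.structureSheaf X))
      (hF : WellNighAffine.IsQuasiCoherent F) (n : ℕ) (hn : 1 ≤ n)
      (ξ : WellNighAffine.Cohomology F n) : d • ξ = 0 := by
    obtain ⟨n, rfl⟩ := Nat.exists_eq_add_of_le' hn
    exact hF.nsmul_cohomology_eq_zero (y := ⟨Y, π⟩) hπ n ξ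
  exact ⟨main _ (WellNighAffine.isQuasiCoherent_unit X), main⟩
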